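/- Assume the Lindelöf hypothesis, i.e. $\zeta(\tfrac12+it)\ll_{\epsilon} t^{\epsilon}$ as $t\to\infty$ for every $\epsilon>0$. Call a positive integer $n$ an almost cube if $n=n_1n_2n_3$ with positive integers satisfying $c\,n^{1/3}\le n_1,n_2,n_3\le C\,n^{1/3}$, where $0<c<1<C$ are fixed constants. Then there is an admissible choice of absolute constants $c,C$ such that, for every $\epsilon>0$, the Lebesgue measure of the set of real $x\in[X,2X]$ for which the interval $[x,x+x^{\epsilon}]$ contains no almost cube $n=n_1n_2n_3$ with $$\tfrac12 x^{1/3}\le n_1,n_2,n_3\le 2x^{1/3}$$ is $o(X)$ as $X\to\infty$ (the rate may depend on $\epsilon$). -/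

import Mathlib

/-- The Lindelöf hypothesis: for every `ε > 0`, `ζ(1/2 + it) ≪_ε t ^ ε` as `t → ∞`. -/
def LindelofHypothesis : Prop :=
  ∀ ε : ℝ, 0 < ε →
    (fun t : ℝ => riemannZeta (1 / 2 + (t : ℂ) * Complex.I)) =O[Filter.atTop]
      (fun t : ℝ => t ^ ε)

/-- The positive integer `n` is an almost `k`-th power with factors `f 0, …, f (k - 1)`
and constants `c`, `C`: `n` is the product of the `f i`, and each of these lies between
`c * n ^ (1 / k)` and `C * n ^ (1 / k)`. -/
def IsAlmostPowerFactorization (c C : ℝ) {k : ℕ} (n : ℕ) (f : Fin k → ℕ) : Prop :=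
  0 < n ∧ n = ∏ i, f i ∧
    ∀ i, c * (n : ℝ) ^ (1 / (k : ℝ)) ≤ (f i : ℝ) ∧ (f i : ℝ) ≤ C * (n : ℝ) ^ (1 / (k : ℝ))

/-- The interval `[x, x + x ^ ε]` contains an almost cube `n = n₁ n₂ n₃` (with constants
`c`, `C`) whose factors satisfy `x ^ (1/3) / 2 ≤ nᵢ ≤ 2 x ^ (1/3)`. -/
def HasNearbyAlmostCube (c C ε x : ℝ) : Prop :=
  ∃ (n : ℕ) (f : Fin 3 → ℕ), IsAlmostPowerFactorization c C n f ∧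
    (n : ℝ) ∈ Set.Icc x (x + x ^ ε) ∧
    ∀ i, x ^ (1 / 3 : ℝ) / 2 ≤ (f i : ℝ) ∧ (f i : ℝ) ≤ 2 * x ^ (1 / 3 : ℝ)

open MeasureTheory Set Filter Complex
open scoped FourierTransform Topology ContDiff

/-! Work in logarithmic coordinates with `u = log x` and `exp L = X^(1/3)`. `tripleSum` counts
triples smoothly, each factor near `exp L`, with a kernel of width `δ` placed so that the product
lies just to the right of `exp u`. Take a fine scale `δ`, of order `X^(ε-1)`, and a coarse scale `δ'
= X^(-1/6)`. At an exceptional `x` the fine count is zero. The coarse count is always at least a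
constant times `X`, because its window is long enough for elementary counting
(`le_tripleSum_dilate`). The difference `D` of the two counts is therefore large on the exceptional
set, and by Chebyshev it suffices to bound `∫ D²`.

By Plancherel (`integral_sq_tripleSum`), `∫ D²` equals the integral of `|F|^6` times the squared
difference of the two kernel transforms, where `F` is the exponential sum `smoothSum`. Under
Lindelöf, `F(t) ≪ exp L/(1+|t|) + exp(L/2)(1+|t|)^η` (`exists_norm_smoothSum_le`). The first term is
harmless because the kernel transforms agree at `0`; it contributes `X² δ'²`. The second contributes
`X δ^(-1-6η)`, which for `η = ε/6` has order `X^(2-ε²)`. Both are `o(X²)`.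

The bound for `F` needs no contour shift. The Fourier transform of `exp(-u/2){exp u}` is `-ζ(s)/s`
on the critical line, so Euler summation with the multiplication formula for Fourier transforms
expresses the sum directly through `ζ(1/2+it)`. -/

/-! ### Zeta as a Mellin transform of the fractional part. -/

/-- The Mellin transform of the fractional part restricted to `(1, ∞)`. -/
noncomputable def mellinFractTail (s : ℂ) : ℂ :=
  mellin ((Ioi (1 : ℝ)).indicator fun x => ((Int.fract x : ℝ) : ℂ)) (-s)

theorem locallyIntegrableOn_fract_tail :
    LocallyIntegrableOn ((Ioi (1 : ℝ)).indicator fun x => ((Int.fract x : ℝ) : ℂ)) (Ioi 0) := by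
  refine LocallyIntegrable.locallyIntegrableOn ?_ _
  refine LocallyIntegrable.indicator ?_ measurableSet_Ioi
  refine (locallyIntegrable_const (1 : ℝ)).mono ?_ ?_
  · exact (Complex.measurable_ofReal.comp measurable_fract).aestronglyMeasurable
  · refine Eventually.of_forall fun x => ?_
    simp [abs_of_nonneg (Int.fract_nonneg x), (Int.fract_lt_one x).le]

theorem fract_tail_isBigO_atTop :
    ((Ioi (1 : ℝ)).indicator fun x => ((Int.fract x : ℝ) : ℂ)) =O[atTop] (fun x : ℝ => x ^ (-(0 : ℝ))) := by
  refine Asymptotics.IsBigO.of_bound 1 (Eventually.of_forall fun x => ?_)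
  by_cases hx : x ∈ Ioi (1 : ℝ)
  · simp [indicator_of_mem hx, abs_of_nonneg (Int.fract_nonneg x), (Int.fract_lt_one x).le]
  · simp [indicator_of_notMem hx]

theorem fract_tail_isBigO_zero (b : ℝ) :
    ((Ioi (1 : ℝ)).indicator fun x => ((Int.fract x : ℝ) : ℂ)) =O[𝓝[>] 0] (fun x : ℝ => x ^ (-b)) := by
  refine Asymptotics.IsBigO.of_bound 1 ?_
  filter_upwards [Ioo_mem_nhdsGT (zero_lt_one : (0 : ℝ) < 1)] with x hx
  rw [indicator_of_notMem (by simpa using hx.2.le)]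
  simp

theorem mellinConvergent_fract_tail {s : ℂ} (hs : 0 < s.re) :
    MellinConvergent ((Ioi (1 : ℝ)).indicator fun x => ((Int.fract x : ℝ) : ℂ)) (-s) :=
  mellinConvergent_of_isBigO_rpow locallyIntegrableOn_fract_tail fract_tail_isBigO_atTop
    -- The function vanishes near `0`, so any exponent below `-s.re` serves here.
    (by simpa using hs) (fract_tail_isBigO_zero (-s.re - 1)) (by simp)

theorem differentiableAt_mellinFractTail {s : ℂ} (hs : 0 < s.re) :
    DifferentiableAt ℂ mellinFractTail s := by
  have h := mellin_differentiableAt_of_isBigO_rpow (s := -s) locallyIntegrableOn_fract_tail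
    fract_tail_isBigO_atTop (by simpa using hs) (fract_tail_isBigO_zero (-s.re - 1)) (by simp)
  exact h.comp s differentiableAt_id.neg

theorem cpow_smul_indicator_fract (s : ℂ) :
    (fun t : ℝ => (t : ℂ) ^ (-s - 1) •
      (Ioi (1 : ℝ)).indicator (fun x => ((Int.fract x : ℝ) : ℂ)) t) =
    (Ioi (1 : ℝ)).indicator fun t => (t : ℂ) ^ (-(s + 1)) * ((Int.fract t : ℝ) : ℂ) := by
  ext t
  by_cases ht : t ∈ Ioi (1 : ℝ)
  · rw [indicator_of_mem ht, indicator_of_mem ht, smul_eq_mul, neg_add']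
  · rw [indicator_of_notMem ht, indicator_of_notMem ht, smul_zero]

theorem mellinFractTail_eq (s : ℂ) :
    mellinFractTail s = ∫ t in Ioi (1 : ℝ), (t : ℂ) ^ (-(s + 1)) * ((Int.fract t : ℝ) : ℂ) := by
  rw [mellinFractTail, mellin, cpow_smul_indicator_fract, setIntegral_indicator measurableSet_Ioi,
    inter_eq_self_of_subset_right (Ioi_subset_Ioi zero_le_one)]

theorem integrableOn_fract_tail {s : ℂ} (hs : 0 < s.re) :
    IntegrableOn (fun t : ℝ => (t : ℂ) ^ (-(s + 1)) * ((Int.fract t : ℝ) : ℂ)) (Ioi 1) := by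
  have h := mellinConvergent_fract_tail hs
  rw [MellinConvergent, cpow_smul_indicator_fract, IntegrableOn,
    integrable_indicator_iff measurableSet_Ioi, IntegrableOn,
    Measure.restrict_restrict measurableSet_Ioi,
    inter_eq_self_of_subset_left (Ioi_subset_Ioi zero_le_one)] at h
  exact h

/-- Partial summation gives `ζ(s) = s ∫ ⌊t⌋ t^(-s-1)`; then split `⌊t⌋ = t - {t}`. -/
theorem riemannZeta₁_eq_of_one_lt_re {s : ℂ} (hs : 1 < s.re) :
    riemannZeta₁ s = s - s * (s - 1) * mellinFractTail s := by
  have hs1 : s ≠ 1 := by rintro rfl; simp at hs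
  have hs1' : s - 1 ≠ 0 := sub_ne_zero.2 hs1
  have h1 : riemannZeta s = s * ∫ t in Ioi (1 : ℝ), ((⌊t⌋₊ : ℂ)) * (t : ℂ) ^ (-(s + 1)) := by
    rw [← LSeries_one_eq_riemannZeta hs, LSeries_eq_mul_integral' 1 zero_le_one hs]
    · simp
    · simp only [Pi.one_apply, norm_one, Finset.sum_const, Nat.card_Icc, add_tsub_cancel_right,
        nsmul_eq_mul, mul_one, Real.rpow_one]
      exact Asymptotics.isBigO_refl _ _
  have h2 : ∫ t in Ioi (1 : ℝ), ((⌊t⌋₊ : ℂ)) * (t : ℂ) ^ (-(s + 1)) =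
      (∫ t in Ioi (1 : ℝ), (t : ℂ) ^ (-s)) - mellinFractTail s := by
    rw [mellinFractTail_eq, ← integral_sub]
    · refine setIntegral_congr_fun measurableSet_Ioi fun t ht => ?_
      have ht0 : (0 : ℝ) < t := zero_lt_one.trans ht
      have e1 : (⌊t⌋₊ : ℂ) = (t : ℂ) - ((Int.fract t : ℝ) : ℂ) := by
        rw [← ofReal_sub, Int.self_sub_fract, ← natCast_floor_eq_intCast_floor ht0.le]; simp
      have e2 : (t : ℂ) * (t : ℂ) ^ (-(s + 1)) = (t : ℂ) ^ (-s) := by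
        have ht' : (t : ℂ) ≠ 0 := by exact_mod_cast ht0.ne'
        nth_rewrite 1 [← cpow_one (t : ℂ)]
        rw [← cpow_add _ _ ht']; ring_nf
      simp only [e1, sub_mul, e2]; ring
    · exact integrableOn_Ioi_cpow_of_lt (by simpa using hs) zero_lt_one
    · exact integrableOn_fract_tail (zero_lt_one.trans hs)
  rw [riemannZeta_eq_inv_sub_mul hs1, h2,
    integral_Ioi_cpow_of_lt (by simpa using hs) zero_lt_one] at h1
  have h3 : (-s + 1 : ℂ) = -(s - 1) := by ring
  rw [h3, ofReal_one, one_cpow, neg_div_neg_eq, inv_mul_eq_iff_eq_mul₀ hs1'] at h1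
  rw [h1]
  field_simp

/-- Identity theorem from a neighbourhood of `2`. Using the entire function `riemannZeta₁` removes
the pole, so the whole half-plane is available. -/
theorem riemannZeta₁_eq_mellinFractTail {s : ℂ} (hs : 0 < s.re) :
    riemannZeta₁ s = s - s * (s - 1) * mellinFractTail s := by
  have hU : IsOpen {s : ℂ | 0 < s.re} := isOpen_lt continuous_const continuous_re
  have hpre : IsPreconnected {s : ℂ | 0 < s.re} := (convex_halfSpace_re_gt 0).isPreconnected
  refine AnalyticOnNhd.eqOn_of_preconnected_of_eventuallyEq (z₀ := 2)
    (f := riemannZeta₁) (g := fun s => s - s * (s - 1) * mellinFractTail s)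
    (differentiable_riemannZeta₁.differentiableOn.analyticOnNhd hU)
    (DifferentiableOn.analyticOnNhd (fun z hz => ?_) hU) hpre (by simp) ?_ hs
  · have := differentiableAt_mellinFractTail hz
    exact (by fun_prop : DifferentiableAt ℂ (fun s => s - s * (s - 1) * mellinFractTail s) z).differentiableWithinAt
  · filter_upwards [(isOpen_lt continuous_const continuous_re).mem_nhds
      (by simp : (2 : ℂ) ∈ {s : ℂ | 1 < s.re})] with z hz
    exact riemannZeta₁_eq_of_one_lt_re hz

/-- On `(0, 1)` one has `{x} = x`, which contributes `1/(1-s)` and cancels the term `1/(s-1)` of the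
tail. -/
theorem hasMellin_fract {s : ℂ} (h0 : 0 < s.re) (h1 : s.re < 1) :
    HasMellin (fun x => ((Int.fract x : ℝ) : ℂ)) (-s) (- riemannZeta s / s) := by
  have hs0 : s ≠ 0 := by rintro rfl; simp at h0
  have hs1 : s ≠ 1 := by rintro rfl; simp at h1
  have hs1' : s - 1 ≠ 0 := sub_ne_zero.2 hs1
  have hA := hasMellin_cpow_Ioc 1 (s := -s) (by simpa using h1)
  have hB := mellinConvergent_fract_tail h0
  have hAB := hasMellin_add hA.1 hB
  have hae : (fun t : ℝ => (t : ℂ) ^ (-s - 1) • ((Ioc 0 1).indicator (fun t : ℝ => (t : ℂ) ^ (1 : ℂ)) t +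
      (Ioi (1 : ℝ)).indicator (fun x => ((Int.fract x : ℝ) : ℂ)) t))
      =ᵐ[volume.restrict (Ioi 0)] fun t => (t : ℂ) ^ (-s - 1) • ((Int.fract t : ℝ) : ℂ) := by
    filter_upwards [ae_restrict_mem measurableSet_Ioi,
      ae_restrict_of_ae (Measure.ae_ne volume (1 : ℝ))] with t ht ht1
    rcases lt_or_gt_of_ne ht1 with h | h
    · rw [indicator_of_mem (show t ∈ Ioc (0 : ℝ) 1 from ⟨ht, h.le⟩),
        indicator_of_notMem (show t ∉ Ioi (1 : ℝ) by simpa using h.le), Int.fract_eq_self.2 ⟨le_of_lt ht, h⟩]; simp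
    · rw [indicator_of_mem (show t ∈ Ioi (1 : ℝ) from h),
        indicator_of_notMem (show t ∉ Ioc (0 : ℝ) 1 by simp [h]), zero_add]
  refine ⟨Integrable.congr hAB.1 hae, ?_⟩
  rw [mellin, ← integral_congr_ae hae]
  refine hAB.2.trans ?_
  rw [hA.2, riemannZeta_eq_inv_sub_mul hs1, riemannZeta₁_eq_mellinFractTail h0, mellinFractTail]
  have h3 : (-s + 1 : ℂ) = -(s - 1) := by ring
  rw [h3]
  field_simp
  ring

/-! ### The critical line as a Fourier transform. -/

/-- The point `1/2 + 2πiτ` on the critical line. -/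
noncomputable def criticalPoint (τ : ℝ) : ℂ := 1 / 2 + 2 * Real.pi * τ * I

theorem criticalPoint_re (τ : ℝ) : (criticalPoint τ).re = 1 / 2 := by
  simp [criticalPoint]

theorem criticalPoint_im (τ : ℝ) : (criticalPoint τ).im = 2 * Real.pi * τ := by
  simp [criticalPoint]

/-- The fractional part in logarithmic coordinates, with weight `exp (-u/2)`. -/
noncomputable def fractExp (u : ℝ) : ℂ := (Real.exp (-(u / 2)) * Int.fract (Real.exp u) : ℝ)

/-- `mellin_eq_fourier` substitutes `x = exp(-u)`; inverting `x` beforehand produces `{exp u}`. -/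
theorem hasMellin_fract_inv (τ : ℝ) :
    HasMellin (fun x => ((Int.fract x⁻¹ : ℝ) : ℂ)) (criticalPoint τ)
      (-riemannZeta (criticalPoint τ) / criticalPoint τ) := by
  have h := hasMellin_fract (s := criticalPoint τ) (by simp [criticalPoint_re])
    (by rw [criticalPoint_re]; norm_num)
  refine ⟨?_, by rw [mellin_comp_inv (fun x => ((Int.fract x : ℝ) : ℂ)), h.2]⟩
  have h2 := (MellinConvergent.comp_rpow (f := fun x => ((Int.fract x : ℝ) : ℂ))
    (s := criticalPoint τ) (a := -1) (by norm_num)).2 (by simpa [div_neg] using h.1)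
  simpa [Real.rpow_neg_one] using h2

theorem fourier_fractExp (τ : ℝ) :
    𝓕 fractExp τ = -riemannZeta (criticalPoint τ) / criticalPoint τ := by
  rw [← (hasMellin_fract_inv τ).2, mellin_eq_fourier, criticalPoint_re, criticalPoint_im]
  have h : 2 * Real.pi * τ / (2 * Real.pi) = τ := by
    field_simp [Real.pi_ne_zero]
  rw [h]
  refine congrArg (fun f : ℝ → ℂ => 𝓕 f τ) (funext fun u => ?_)
  simp only [fractExp, ← Real.exp_neg, neg_neg, real_smul, ← ofReal_mul]
  ring_nf

theorem norm_fractExp_le (u : ℝ) : ‖fractExp u‖ ≤ Real.exp (-(1/2) * |u|) := by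
  rw [fractExp, Complex.norm_real, Real.norm_of_nonneg (by positivity)]
  rcases le_or_gt 0 u with h | h
  · rw [abs_of_nonneg h]
    calc _ ≤ Real.exp (-(u / 2)) * 1 := by gcongr; exact (Int.fract_lt_one _).le
      _ = _ := by ring_nf
  · rw [abs_of_neg h, Int.fract_eq_self.2 ⟨(Real.exp_pos _).le, by simpa using h⟩, ← Real.exp_add]
    apply le_of_eq; ring_nf

theorem integrable_fractExp : Integrable fractExp := by
  refine (integrable_inv_one_add_sq.const_mul 8).mono' ?_ (Eventually.of_forall fun u => ?_)
  · unfold fractExp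
    exact (Complex.measurable_ofReal.comp ((Real.measurable_exp.comp (by fun_prop)).mul
      (measurable_fract.comp Real.measurable_exp))).aestronglyMeasurable
  · refine (norm_fractExp_le u).trans ?_
    have h := Real.quadratic_le_exp_of_nonneg (show 0 ≤ 1 / 2 * |u| by positivity)
    rw [neg_mul, Real.exp_neg, ← div_eq_mul_inv, inv_eq_one_div, div_le_div_iff₀ (Real.exp_pos _)
      (by positivity)]
    have h2 : |u| ^ 2 = u ^ 2 := sq_abs u
    nlinarith [abs_nonneg u]

/-! ### Euler summation and smooth sums as zeta integrals. -/

theorem sum_indicator_log_le {M : ℕ} (hM : 0 < M) {u : ℝ} (hu : u ≤ Real.log M) (z : ℂ) :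
    ∑ n ∈ Finset.Icc 1 M, (Ici (Real.log n)).indicator (fun _ => z) u =
      (⌊Real.exp u⌋₊ : ℂ) * z := by
  have hfl : ⌊Real.exp u⌋₊ ≤ M := by
    have : Real.exp u ≤ M := by
      rw [← Real.exp_log (show (0 : ℝ) < M by exact_mod_cast hM)]
      exact Real.exp_le_exp.2 hu
    exact Nat.floor_le_of_le this
  have h1 : ∀ n ∈ Finset.Icc 1 M, (Ici (Real.log n)).indicator (fun _ => z) u =
      if n ∈ Finset.Icc 1 ⌊Real.exp u⌋₊ then z else 0 := by
    intro n hn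
    have hn1 := (Finset.mem_Icc.1 hn).1
    have hn0 : (0 : ℝ) < n := by exact_mod_cast hn1
    simp only [indicator, mem_Ici, Finset.mem_Icc, hn1, true_and, Nat.le_floor_iff (Real.exp_pos u).le,
      Real.log_le_iff_le_exp hn0]
  rw [Finset.sum_congr rfl h1, ← Finset.sum_filter, Finset.filter_mem_eq_inter,
    Finset.inter_eq_right.2 (Finset.Icc_subset_Icc_right hfl)]
  simp

/-- Euler summation for a compactly supported function of `log n`. -/
theorem sum_log_eq_integral_add {g : ℝ → ℂ} (hg : ContDiff ℝ 1 g) (hc : HasCompactSupport g)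
    {M : ℕ} (hM0 : 0 < M) (hM : ∀ u, Real.log M < u → g u = 0) :
    ∑ n ∈ Finset.Icc 1 M, g (Real.log n) =
      (∫ u, g u * (Real.exp u : ℂ)) + ∫ u, ((Int.fract (Real.exp u) : ℝ) : ℂ) * deriv g u := by
  have hdc : Continuous (deriv g) := hg.continuous_deriv le_rfl
  have hdi : Integrable (deriv g) := hdc.integrable_of_hasCompactSupport hc.deriv
  have hd0 : ∀ u, Real.log M < u → deriv g u = 0 := fun u hu => by
    have : g =ᶠ[𝓝 u] fun _ => 0 := by
      filter_upwards [Ioi_mem_nhds hu] with v hv using hM v hv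
    rw [this.deriv_eq]; simp
  -- Each value of `g` is minus a tail integral of `g'`; summing over `n` puts the weight `⌊exp u⌋`
  -- on `g'`.
  have h1 : ∀ n : ℕ, g (Real.log n) = -∫ u, (Ici (Real.log n)).indicator (deriv g) u := fun n => by
    rw [integral_indicator measurableSet_Ici, integral_Ici_eq_integral_Ioi,
      hc.integral_Ioi_deriv_eq hg, neg_neg]
  have hexp : Continuous fun u : ℝ => (Real.exp u : ℂ) := continuous_ofReal.comp Real.continuous_exp
  have hi1 : Integrable fun u => deriv g u * (Real.exp u : ℂ) :=
    (hdc.mul hexp).integrable_of_hasCompactSupport hc.deriv.mul_right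
  have hi2 : Integrable fun u => g u * (Real.exp u : ℂ) :=
    (hg.continuous.mul hexp).integrable_of_hasCompactSupport hc.mul_right
  have hi3 : Integrable fun u => ((Int.fract (Real.exp u) : ℝ) : ℂ) * deriv g u := by
    refine hdi.bdd_mul (c := 1) ?_ (Eventually.of_forall fun u => ?_)
    · exact (Complex.measurable_ofReal.comp
        (measurable_fract.comp Real.measurable_exp)).aestronglyMeasurable
    · simp [abs_of_nonneg (Int.fract_nonneg (Real.exp u)), (Int.fract_lt_one (Real.exp u)).le]
  have hparts : ∫ u, g u * (Real.exp u : ℂ) = -∫ u, deriv g u * (Real.exp u : ℂ) :=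
    integral_mul_deriv_eq_deriv_mul_of_integrable
      (fun x _ => (hg.differentiable one_ne_zero x).hasDerivAt)
      (fun x _ => (Real.hasDerivAt_exp x).ofReal_comp) hi2 hi1 hi2
  rw [Finset.sum_congr rfl fun n _ => h1 n, Finset.sum_neg_distrib,
    ← integral_finsetSum _ fun n _ => hdi.indicator measurableSet_Ici, hparts, neg_add_eq_sub,
    ← integral_sub hi3 hi1, ← integral_neg]
  refine integral_congr_ae (Eventually.of_forall fun u => ?_)
  simp only
  have e1 : (⌊Real.exp u⌋₊ : ℂ) = (Real.exp u : ℂ) - ((Int.fract (Real.exp u) : ℝ) : ℂ) := by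
    rw [← ofReal_sub, Int.self_sub_fract, ← natCast_floor_eq_intCast_floor (Real.exp_pos u).le]
    simp
  have e2 : ∀ n : ℕ, (Ici (Real.log n)).indicator (deriv g) u =
      (Ici (Real.log n)).indicator (fun _ => deriv g u) u := fun n => rfl
  rcases le_or_gt u (Real.log M) with hu | hu
  · rw [Finset.sum_congr rfl fun n _ => e2 n, sum_indicator_log_le hM0 hu, e1]; ring
  · rw [Finset.sum_congr rfl fun n _ => e2 n, hd0 u hu]; simp

theorem criticalPoint_ne_zero (τ : ℝ) : criticalPoint τ ≠ 0 := fun h => by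
  have := congrArg Complex.re h
  rw [criticalPoint_re] at this
  norm_num at this

/-- The multiplication formula `∫ f̂ R = ∫ f R̂` with `R = 𝓕⁻ Q`; it asks only that `fractExp` be
integrable. -/
theorem integral_fractExp_mul (Q : SchwartzMap ℝ ℂ) :
    ∫ u, fractExp u * Q u =
      ∫ τ, -riemannZeta (criticalPoint τ) / criticalPoint τ * 𝓕⁻ (Q : ℝ → ℂ) τ := by
  let R : SchwartzMap ℝ ℂ := 𝓕⁻ Q
  have h := VectorFourier.integral_fourierIntegral_smul_eq_flip (L := innerₗ ℝ)
      Real.continuous_fourierChar continuous_inner integrable_fractExp (R.integrable (μ := volume))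
  have h2 : (𝓕 R : SchwartzMap ℝ ℂ) = Q := FourierTransform.fourier_fourierInv_eq Q
  have h3 : ∀ u, 𝓕 (R : ℝ → ℂ) u = Q u := fun u => by
    rw [← SchwartzMap.fourier_coe, h2]
  have h4 : ∫ τ, 𝓕 fractExp τ * R τ = ∫ u, fractExp u * 𝓕 (R : ℝ → ℂ) u := by
    simpa using! h
  have h5 : (R : ℝ → ℂ) = 𝓕⁻ (Q : ℝ → ℂ) := SchwartzMap.fourierInv_coe Q
  simp only [h3, fourier_fractExp] at h4
  rw [← h4, h5]

/-- `P' - P/2` arises from differentiating `exp(-u/2) P(u)`. The factor `-criticalPoint τ` cancels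
the denominator in `fourier_fractExp`. -/
theorem fourierInv_deriv_sub_half (P : SchwartzMap ℝ ℂ) (τ : ℝ) :
    𝓕⁻ (fun u => deriv P u - P u / 2) τ = -criticalPoint τ * 𝓕⁻ (P : ℝ → ℂ) τ := by
  have hd : Integrable (deriv P) := (SchwartzMap.derivCLM ℂ ℂ P).integrable
  have h1 : 𝓕 (deriv P) (-τ) = 2 * Real.pi * I * (-τ : ℝ) * 𝓕 (P : ℝ → ℂ) (-τ) := by
    rw [Real.fourier_deriv P.integrable P.differentiable hd]; simp
  have h2 : 𝓕 (fun u => deriv P u - P u / 2) (-τ) =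
      𝓕 (deriv P) (-τ) - 𝓕 (P : ℝ → ℂ) (-τ) / 2 := by
    simp only [Real.fourier_real_eq, smul_sub]
    rw [integral_sub]
    · congr 1
      rw [← integral_div]
      simp only [Circle.smul_def, smul_eq_mul, mul_div_assoc]
    · simpa [mul_comm] using (Real.fourierIntegral_convergent_iff (-τ)).2 hd
    · simpa [mul_comm] using (Real.fourierIntegral_convergent_iff (-τ)).2
        ((P.integrable (μ := volume)).div_const 2)
  rw [Real.fourierInv_eq_fourier_neg, Real.fourierInv_eq_fourier_neg, h2, h1, criticalPoint]
  push_cast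
  ring

/-- A smooth sum over `n ^ (-1/2)` minus its main term is an integral of `ζ` over the
critical line. -/
theorem sum_sub_integral_eq_integral_zeta {P : ℝ → ℂ} (hP : ContDiff ℝ ∞ P)
    (hc : HasCompactSupport P) {M : ℕ} (hM0 : 0 < M) (hM : ∀ u, Real.log M < u → P u = 0) :
    ∑ n ∈ Finset.Icc 1 M, (Real.exp (-(Real.log n / 2)) : ℂ) * P (Real.log n) =
      (∫ u, P u * (Real.exp (u / 2) : ℂ)) +
        ∫ τ, riemannZeta (criticalPoint τ) * 𝓕⁻ P τ := by
  have hE : ∀ u : ℝ, HasDerivAt (fun u : ℝ => (Real.exp (-(u / 2)) : ℂ))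
      (-(1 / 2) * (Real.exp (-(u / 2)) : ℂ)) u := fun u => by
    have h1 : HasDerivAt (fun u : ℝ => -(u / 2)) (-(1 / 2)) u :=
      ((hasDerivAt_id' u).div_const 2).fun_neg
    have := h1.exp.ofReal_comp
    rwa [ofReal_mul, mul_comm, show ((-(1 / 2) : ℝ) : ℂ) = -(1 / 2) by push_cast; rfl] at this
  have hEc : ContDiff ℝ ∞ (fun u : ℝ => (Real.exp (-(u / 2)) : ℂ)) :=
    ofRealCLM.contDiff.comp (by fun_prop : ContDiff ℝ ∞ fun u : ℝ => Real.exp (-(u / 2)))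
  have hd : ∀ u, deriv (fun u => (Real.exp (-(u / 2)) : ℂ) * P u) u =
      (Real.exp (-(u / 2)) : ℂ) * (deriv P u - P u / 2) := fun u => by
    rw [((hE u).fun_mul (hP.differentiable (by simp) u).hasDerivAt).deriv]; ring
  have hg : ContDiff ℝ ∞ (fun u => (Real.exp (-(u / 2)) : ℂ) * P u) := hEc.mul hP
  rw [sum_log_eq_integral_add (g := fun u => (Real.exp (-(u / 2)) : ℂ) * P u)
    (hg.of_le (by simp)) hc.mul_left hM0 (fun u hu => by simp [hM u hu])]
  congr 1
  · refine integral_congr_ae (Eventually.of_forall fun u => ?_)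
    simp only
    rw [mul_right_comm, ← ofReal_mul, ← Real.exp_add, mul_comm]
    ring_nf
  · set Ps : SchwartzMap ℝ ℂ := hc.toSchwartzMap hP with hPs
    have hcoe : (Ps : ℝ → ℂ) = P := rfl
    set Q : SchwartzMap ℝ ℂ := SchwartzMap.derivCLM ℂ ℂ Ps - (1 / 2 : ℂ) • Ps with hQ
    have hQc : (Q : ℝ → ℂ) = fun u => deriv Ps u - Ps u / 2 := by
      ext u
      simp [hQ, SchwartzMap.derivCLM_apply, div_eq_inv_mul]
    have := integral_fractExp_mul Q
    simp_rw [hd]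
    rw [hQc] at this
    simp_rw [fourierInv_deriv_sub_half] at this
    rw [hcoe] at this
    refine Eq.trans ?_ (this.trans ?_)
    · refine integral_congr_ae (Eventually.of_forall fun u => ?_)
      simp only [fractExp]; push_cast; ring
    · refine integral_congr_ae (Eventually.of_forall fun τ => ?_)
      have := criticalPoint_ne_zero τ
      simp only
      field_simp

/-! ### Lindelöf bounds for smooth exponential sums. -/

theorem exists_norm_riemannZeta_criticalPoint_le (hL : LindelofHypothesis) {η : ℝ} (hη : 0 < η) :
    ∃ C : ℝ, 0 < C ∧ ∀ τ : ℝ, ‖riemannZeta (criticalPoint τ)‖ ≤ C * (1 + |τ|) ^ η := by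
  obtain ⟨c, hc⟩ := (hL η hη).bound
  obtain ⟨T, hT⟩ := eventually_atTop.1 hc
  have hcont : Continuous fun τ : ℝ => riemannZeta (criticalPoint τ) := by
    refine continuous_iff_continuousAt.2 fun τ => ?_
    refine ContinuousAt.comp (f := criticalPoint) (g := riemannZeta)
      (differentiableAt_riemannZeta fun h => ?_).continuousAt ?_
    · have := congrArg Complex.re h
      rw [criticalPoint_re] at this
      norm_num at this
    · unfold criticalPoint
      fun_prop
  obtain ⟨B, hB⟩ := (isCompact_Icc (a := -|T|) (b := |T|)).exists_bound_of_continuousOn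
    hcont.continuousOn
  have hpi : (1 : ℝ) ≤ 2 * Real.pi := by linarith [Real.pi_gt_three]
  -- Lindelöf covers large positive `τ` and compactness the bounded ones; conjugation then gives
  -- negative `τ`.
  have key : ∀ τ : ℝ, 0 ≤ τ → ‖riemannZeta (criticalPoint τ)‖ ≤
      (|c| * (2 * Real.pi) ^ η + |B| + 1) * (1 + |τ|) ^ η := by
    intro τ hτ
    have h1 : (1 : ℝ) ≤ (1 + |τ|) ^ η := Real.one_le_rpow (by simp) hη.le
    have hp : 0 ≤ |c| * (2 * Real.pi) ^ η := by positivity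
    rcases le_or_gt τ |T| with h | h
    · have := hB τ ⟨by linarith [abs_nonneg T], h⟩
      nlinarith [le_abs_self B, abs_nonneg B]
    · have ht : T ≤ 2 * Real.pi * τ := by nlinarith [le_abs_self T]
      have h2 := hT _ ht
      have h3 : (1 / 2 + ((2 * Real.pi * τ : ℝ) : ℂ) * I) = criticalPoint τ := by
        simp [criticalPoint]
      rw [h3, Real.norm_of_nonneg (by positivity), Real.mul_rpow (by positivity) hτ] at h2
      have h4 : τ ^ η ≤ (1 + |τ|) ^ η :=
        Real.rpow_le_rpow hτ (by rw [abs_of_nonneg hτ]; linarith) hη.le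
      calc _ ≤ c * ((2 * Real.pi) ^ η * τ ^ η) := h2
        _ ≤ |c| * ((2 * Real.pi) ^ η * (1 + |τ|) ^ η) := by
            gcongr
            exact le_abs_self c
        _ ≤ _ := by nlinarith [abs_nonneg B]
  refine ⟨|c| * (2 * Real.pi) ^ η + |B| + 1, by positivity, fun τ => ?_⟩
  · rcases le_total 0 τ with h | h
    · exact key τ h
    · have h1 := key (-τ) (by linarith)
      have h2 : criticalPoint (-τ) = (starRingEnd ℂ) (criticalPoint τ) :=
        Complex.ext (by rw [conj_re, criticalPoint_re, criticalPoint_re])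
          (by rw [conj_im, criticalPoint_im, criticalPoint_im, mul_neg])
      rwa [h2, riemannZeta_conj, Complex.norm_conj, abs_neg] at h1

theorem SchwartzMap.exists_norm_le_one_add_abs_pow (f : SchwartzMap ℝ ℂ) (k : ℕ) :
    ∃ C : ℝ, 0 < C ∧ ∀ x : ℝ, ‖f x‖ ≤ C * ((1 + |x|) ^ k)⁻¹ := by
  have h := fun x => SchwartzMap.one_add_le_sup_seminorm_apply (𝕜 := ℝ) (m := (k, 0)) le_rfl le_rfl f x
  simp only [norm_iteratedFDeriv_zero, Real.norm_eq_abs] at h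
  set A := 2 ^ (k, 0).1 * ((Finset.Iic (k, 0)).sup fun m => SchwartzMap.seminorm ℝ m.1 m.2) f
  refine ⟨|A| + 1, by positivity, fun x => ?_⟩
  rw [← div_eq_mul_inv, le_div_iff₀ (by positivity), mul_comm]
  linarith [h x, le_abs_self A]

theorem fourier_comp_sub (q : ℝ → ℂ) (a t : ℝ) :
    𝓕 (fun u => q (u - a)) t = (𝐞 (-(t * a)) : ℂ) * 𝓕 q t := by
  rw [Real.fourier_real_eq, Real.fourier_real_eq,
    ← integral_sub_right_eq_self (fun v => 𝐞 (-(v * t)) • q v) a, ← integral_const_mul]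
  refine integral_congr_ae (Eventually.of_forall fun u => ?_)
  simp only [Circle.smul_def, smul_eq_mul]
  rw [← mul_assoc, ← Circle.coe_mul, ← AddChar.map_add_eq_mul]
  ring_nf

theorem norm_fourier_comp_sub (q : ℝ → ℂ) (a t : ℝ) :
    ‖𝓕 (fun u => q (u - a)) t‖ = ‖𝓕 q t‖ := by
  rw [fourier_comp_sub, norm_mul, Circle.norm_coe, one_mul]

/-- The exponential sum `∑ ρ(log n - L) n ^ (-2πit)` over `n ≤ M`. -/
noncomputable def smoothSum (ρ : ℝ → ℝ) (L : ℝ) (M : ℕ) (t : ℝ) : ℂ :=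
  ∑ n ∈ Finset.Icc 1 M, (ρ (Real.log n - L) : ℂ) * (𝐞 (-(t * Real.log n)) : ℂ)

/-- The function `exp (σ u) ρ(u)`, complex valued. -/
noncomputable def expWeight (ρ : ℝ → ℝ) (σ u : ℝ) : ℂ := (Real.exp (σ * u) * ρ u : ℝ)

theorem contDiff_expWeight {ρ : ℝ → ℝ} (hρ : ContDiff ℝ ∞ ρ) (σ : ℝ) :
    ContDiff ℝ ∞ (expWeight ρ σ) :=
  ofRealCLM.contDiff.comp (by fun_prop : ContDiff ℝ ∞ fun u : ℝ => Real.exp (σ * u) * ρ u)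

theorem hasCompactSupport_expWeight {ρ : ℝ → ℝ} (hc : HasCompactSupport ρ) (σ : ℝ) :
    HasCompactSupport (expWeight ρ σ) := by
  refine hc.mono fun u hu => ?_
  contrapose! hu
  simp only [Function.mem_support, not_not] at hu ⊢
  simp [expWeight, hu]

theorem exists_norm_fourier_expWeight_le {ρ : ℝ → ℝ} (hρ : ContDiff ℝ ∞ ρ)
    (hc : HasCompactSupport ρ) (σ : ℝ) (k : ℕ) :
    ∃ C : ℝ, 0 < C ∧ ∀ x : ℝ, ‖𝓕 (expWeight ρ σ) x‖ ≤ C * ((1 + |x|) ^ k)⁻¹ := by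
  let f := (hasCompactSupport_expWeight hc σ).toSchwartzMap (contDiff_expWeight hρ σ)
  let g : SchwartzMap ℝ ℂ := 𝓕 f
  obtain ⟨C, hC, h⟩ := g.exists_norm_le_one_add_abs_pow k
  exact ⟨C, hC, h⟩

theorem norm_fourier_exp_mul_shift (ρ : ℝ → ℝ) (σ L t : ℝ) :
    ‖𝓕 (fun u => ((Real.exp (σ * u) * ρ (u - L) : ℝ) : ℂ)) t‖ =
      Real.exp (σ * L) * ‖𝓕 (expWeight ρ σ) t‖ := by
  have h : (fun u => ((Real.exp (σ * u) * ρ (u - L) : ℝ) : ℂ)) =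
      (fun u => (Real.exp (σ * L) : ℂ) • expWeight ρ σ (u - L)) := by
    ext u
    simp only [expWeight, smul_eq_mul, ← ofReal_mul, ← mul_assoc, ← Real.exp_add]
    ring_nf
  have h2 : 𝓕 (fun u => (Real.exp (σ * L) : ℂ) • expWeight ρ σ (u - L)) t =
      (Real.exp (σ * L) : ℂ) • 𝓕 (fun u => expWeight ρ σ (u - L)) t := by
    simp only [Real.fourier_real_eq]
    rw [← integral_smul]
    simp only [Circle.smul_def, smul_eq_mul]
    refine integral_congr_ae (Eventually.of_forall fun u => ?_)
    simp only
    ring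
  rw [h, h2, norm_smul, norm_fourier_comp_sub, Complex.norm_real,
    Real.norm_of_nonneg (Real.exp_pos _).le]

theorem one_add_abs_le_mul (t τ : ℝ) : 1 + |τ| ≤ (1 + |t|) * (1 + |t - τ|) := by
  have : |τ| ≤ |t| + |t - τ| := by
    have := abs_sub t (t - τ); simpa using this
  nlinarith [abs_nonneg t, abs_nonneg (t - τ), mul_nonneg (abs_nonneg t) (abs_nonneg (t - τ))]

theorem integrable_one_add_abs_rpow {r : ℝ} (hr : 1 < r) :
    Integrable fun x : ℝ => (1 + |x|) ^ (-r) := by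
  simpa using integrable_one_add_norm (E := ℝ) (μ := volume) (r := r) (by simpa using hr)

/-- The constant must not depend on `L`, `M` or `t`. The first term is the transform of `exp(u)
ρ(u-L)`. The second is the zeta integral, concentrated near `τ = t` by the decay of the transform of
the weight. -/
theorem exists_norm_smoothSum_le (hL : LindelofHypothesis) {ρ : ℝ → ℝ} (hρ : ContDiff ℝ ∞ ρ)
    (hc : HasCompactSupport ρ) {η : ℝ} (hη : 0 < η) (hη1 : η ≤ 1) :
    ∃ C : ℝ, 0 < C ∧ ∀ (L : ℝ) (M : ℕ), 0 < M → (∀ u, Real.log M < u → ρ (u - L) = 0) → ∀ t : ℝ,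
      ‖smoothSum ρ L M t‖ ≤
        C * (Real.exp L * (1 + |t|)⁻¹ + Real.exp (L / 2) * (1 + |t|) ^ η) := by
  obtain ⟨Cz, hCz, hz⟩ := exists_norm_riemannZeta_criticalPoint_le hL hη
  obtain ⟨C1, hC1, h1⟩ := exists_norm_fourier_expWeight_le hρ hc 1 1
  -- Of the three powers of decay, one pays for replacing `(1+|τ|)^η` by `(1+|t|)^η`, and two remain
  -- integrable.
  obtain ⟨C2, hC2, h2⟩ := exists_norm_fourier_expWeight_le hρ hc (1 / 2) 3
  set J := ∫ x : ℝ, (1 + |x|) ^ (-2 : ℝ) with hJ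
  have hJ0 : 0 ≤ J := integral_nonneg fun x => by positivity
  refine ⟨C1 + Cz * C2 * J, by positivity, fun L M hM0 hM t => ?_⟩
  -- The factor `exp(u/2)` compensates the weight `n^(-1/2)` in `sum_sub_integral_eq_integral_zeta`.
  let P : ℝ → ℂ := fun u => ((Real.exp (1 / 2 * u) * ρ (u - L) : ℝ) : ℂ) * (𝐞 (-(t * u)) : ℂ)
  have hP : ContDiff ℝ ∞ P := by
    refine ContDiff.mul (ofRealCLM.contDiff.comp
      (by fun_prop : ContDiff ℝ ∞ fun u : ℝ => Real.exp (1 / 2 * u) * ρ (u - L))) ?_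
    simp only [Real.fourierChar_apply]
    exact Complex.contDiff_exp.comp ((ofRealCLM.contDiff.comp
      (by fun_prop : ContDiff ℝ ∞ fun u : ℝ => 2 * Real.pi * (-(t * u)))).mul contDiff_const)
  have hPc : HasCompactSupport P := by
    have : HasCompactSupport fun u => ρ (u - L) :=
      hc.comp_homeomorph (Homeomorph.subRight L)
    refine this.mono fun u hu => ?_
    contrapose! hu
    simp only [Function.mem_support, not_not] at hu ⊢
    simp [P, hu]
  have hmain := sum_sub_integral_eq_integral_zeta hP hPc hM0 (fun u hu => by simp [P, hM u hu])
  have hsum : ∑ n ∈ Finset.Icc 1 M, (Real.exp (-(Real.log n / 2)) : ℂ) * P (Real.log n) =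
      smoothSum ρ L M t := by
    refine Finset.sum_congr rfl fun n _ => ?_
    simp only [P]
    rw [← mul_assoc, ← ofReal_mul, ← mul_assoc, ← Real.exp_add,
      show -(Real.log n / 2) + 1 / 2 * Real.log n = 0 by ring, Real.exp_zero, one_mul]
  have hI : ∫ u, P u * (Real.exp (u / 2) : ℂ) =
      𝓕 (fun u => ((Real.exp (1 * u) * ρ (u - L) : ℝ) : ℂ)) t := by
    rw [Real.fourier_real_eq]
    refine integral_congr_ae (Eventually.of_forall fun u => ?_)
    simp only [P, Circle.smul_def, smul_eq_mul]
    rw [mul_right_comm, ← ofReal_mul, mul_right_comm, ← Real.exp_add, mul_comm]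
    ring_nf
  have hV : ∀ τ, 𝓕⁻ P τ = 𝓕 (fun u => ((Real.exp (1 / 2 * u) * ρ (u - L) : ℝ) : ℂ)) (t - τ) := by
    intro τ
    rw [Real.fourierInv_eq_fourier_neg, Real.fourier_real_eq, Real.fourier_real_eq]
    refine integral_congr_ae (Eventually.of_forall fun u => ?_)
    simp only [P, Circle.smul_def, smul_eq_mul]
    rw [mul_comm _ (𝐞 (-(t * u)) : ℂ), ← mul_assoc, ← Circle.coe_mul, ← AddChar.map_add_eq_mul]
    ring_nf
  rw [hsum, hI] at hmain
  have hb1 : ‖𝓕 (fun u => ((Real.exp (1 * u) * ρ (u - L) : ℝ) : ℂ)) t‖ ≤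
      C1 * (Real.exp L * (1 + |t|)⁻¹) := by
    rw [norm_fourier_exp_mul_shift, one_mul]
    calc _ ≤ Real.exp L * (C1 * ((1 + |t|) ^ 1)⁻¹) := by gcongr; exact h1 t
      _ = _ := by rw [pow_one]; ring
  have hb2 : ‖∫ τ, riemannZeta (criticalPoint τ) * 𝓕⁻ P τ‖ ≤
      Cz * C2 * J * (Real.exp (L / 2) * (1 + |t|) ^ η) := by
    have hint : Integrable fun τ : ℝ => (1 + |t - τ|) ^ (-2 : ℝ) :=
      (integrable_one_add_abs_rpow one_lt_two).comp_sub_left t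
    refine (norm_integral_le_of_norm_le (hint.const_mul
      (Cz * C2 * (Real.exp (L / 2) * (1 + |t|) ^ η))) (Eventually.of_forall fun τ => ?_)).trans ?_
    · rw [norm_mul, hV, norm_fourier_exp_mul_shift]
      have e1 : (1 + |τ|) ^ η ≤ (1 + |t|) ^ η * (1 + |t - τ|) ^ (1 : ℝ) := by
        calc (1 + |τ|) ^ η ≤ ((1 + |t|) * (1 + |t - τ|)) ^ η :=
              Real.rpow_le_rpow (by positivity) (one_add_abs_le_mul t τ) hη.le
          _ = (1 + |t|) ^ η * (1 + |t - τ|) ^ η := Real.mul_rpow (by positivity) (by positivity)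
          _ ≤ _ := by
            gcongr
            · simp
      have e2 : (1 + |t - τ|) ^ (1 : ℝ) * ((1 + |t - τ|) ^ 3)⁻¹ = (1 + |t - τ|) ^ (-2 : ℝ) := by
        rw [← Real.rpow_natCast, ← Real.rpow_neg (by positivity), ← Real.rpow_add (by positivity)]
        norm_num
      calc _ ≤ (Cz * ((1 + |t|) ^ η * (1 + |t - τ|) ^ (1 : ℝ))) *
              (Real.exp (1 / 2 * L) * (C2 * ((1 + |t - τ|) ^ 3)⁻¹)) := by
            gcongr
            · exact (hz τ).trans (by gcongr)
            · exact h2 (t - τ)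
        _ = Cz * C2 * (Real.exp (1 / 2 * L) * (1 + |t|) ^ η) *
              ((1 + |t - τ|) ^ (1 : ℝ) * ((1 + |t - τ|) ^ 3)⁻¹) := by ring
        _ = _ := by rw [e2]; ring_nf
    · rw [integral_const_mul, integral_sub_left_eq_self (fun x : ℝ => (1 + |x|) ^ (-2 : ℝ)) volume t]
      apply le_of_eq; ring
  rw [hmain]
  refine (norm_add_le _ _).trans ((add_le_add hb1 hb2).trans ?_)
  have : 0 ≤ Real.exp L * (1 + |t|)⁻¹ := by positivity
  have : 0 ≤ Real.exp (L / 2) * (1 + |t|) ^ η := by positivity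
  have : 0 ≤ Cz * C2 * J := by positivity
  nlinarith

/-! ### Triple sums and their Fourier transforms. -/

theorem HasCompactSupport.finsetSum {ι : Type*} {s : Finset ι} {f : ι → ℝ → ℝ}
    (h : ∀ i ∈ s, HasCompactSupport (f i)) : HasCompactSupport fun x => ∑ i ∈ s, f i x := by
  classical
  induction s using Finset.induction_on with
  | empty => exact HasCompactSupport.zero
  | insert a s ha ih =>
    simp only [Finset.sum_insert ha]
    exact (h a (Finset.mem_insert_self a s)).add
      (ih fun i hi => h i (Finset.mem_insert_of_mem hi))

/-- The weighted sum of `κ(u - log(n₁ n₂ n₃))` over triples. -/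
noncomputable def tripleSum (ρ : ℝ → ℝ) (L : ℝ) (M : ℕ) (κ : ℝ → ℝ) (u : ℝ) : ℝ :=
  ∑ a ∈ Finset.Icc 1 M, ∑ b ∈ Finset.Icc 1 M, ∑ c ∈ Finset.Icc 1 M,
    ρ (Real.log a - L) * ρ (Real.log b - L) * ρ (Real.log c - L) *
      κ (u - (Real.log a + Real.log b + Real.log c))

theorem tripleSum_sub (ρ : ℝ → ℝ) (L : ℝ) (M : ℕ) (κ₁ κ₂ : ℝ → ℝ) (u : ℝ) :
    tripleSum ρ L M (fun v => κ₁ v - κ₂ v) u = tripleSum ρ L M κ₁ u - tripleSum ρ L M κ₂ u := by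
  simp only [tripleSum, mul_sub, Finset.sum_sub_distrib]

theorem contDiff_tripleSum (ρ : ℝ → ℝ) (L : ℝ) (M : ℕ) {κ : ℝ → ℝ} (hκ : ContDiff ℝ ∞ κ) :
    ContDiff ℝ ∞ (tripleSum ρ L M κ) := by
  unfold tripleSum
  refine ContDiff.sum fun a _ => ContDiff.sum fun b _ => ContDiff.sum fun c _ => ?_
  exact contDiff_const.mul (hκ.comp (contDiff_id.sub contDiff_const))

theorem hasCompactSupport_tripleSum (ρ : ℝ → ℝ) (L : ℝ) (M : ℕ) {κ : ℝ → ℝ}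
    (hκ : HasCompactSupport κ) : HasCompactSupport (tripleSum ρ L M κ) := by
  refine HasCompactSupport.finsetSum fun a _ => HasCompactSupport.finsetSum fun b _ =>
    HasCompactSupport.finsetSum fun c _ => ?_
  exact HasCompactSupport.mul_left (hκ.comp_homeomorph (Homeomorph.subRight _))

theorem fourier_tripleSum (ρ : ℝ → ℝ) (L : ℝ) (M : ℕ) {κ : ℝ → ℝ} (hκ : Integrable κ) (t : ℝ) :
    𝓕 (fun u => (tripleSum ρ L M κ u : ℂ)) t =
      smoothSum ρ L M t ^ 3 * 𝓕 (fun u => (κ u : ℂ)) t := by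
  have hi : ∀ (z : ℂ) (v : ℝ), Integrable fun u => (𝐞 (-(u * t)) : ℂ) * (z * (κ (u - v) : ℂ)) := by
    intro z v
    have h1 : Integrable fun u => z * (κ (u - v) : ℂ) :=
      ((hκ.comp_sub_right v).ofReal).const_mul z
    have := (Real.fourierIntegral_convergent_iff t).2 h1
    simpa [Circle.smul_def, mul_comm] using this
  have h1 : ∀ (z : ℂ) (v : ℝ), ∫ u, (𝐞 (-(u * t)) : ℂ) * (z * (κ (u - v) : ℂ)) =
      z * ((𝐞 (-(t * v)) : ℂ) * 𝓕 (fun u => (κ u : ℂ)) t) := by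
    intro z v
    rw [← fourier_comp_sub (fun u => (κ u : ℂ)), Real.fourier_real_eq, ← integral_const_mul]
    refine integral_congr_ae (Eventually.of_forall fun u => ?_)
    simp only [Circle.smul_def, smul_eq_mul]
    ring
  rw [Real.fourier_real_eq]
  simp only [tripleSum, ofReal_sum, Circle.smul_def, smul_eq_mul, Finset.mul_sum, ofReal_mul]
  simp only [← ofReal_mul]
  have hi' : ∀ a b c : ℕ, Integrable fun u => (𝐞 (-(u * t)) : ℂ) *
      ((ρ (Real.log a - L) * ρ (Real.log b - L) * ρ (Real.log c - L) *
      κ (u - (Real.log a + Real.log b + Real.log c)) : ℝ) : ℂ) := fun a b c => by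
    simpa only [← ofReal_mul] using hi (ρ (Real.log a - L) * ρ (Real.log b - L) * ρ (Real.log c - L) : ℝ)
      (Real.log a + Real.log b + Real.log c)
  rw [integral_finsetSum _ fun a _ => integrable_finsetSum _ fun b _ =>
    integrable_finsetSum _ fun c _ => hi' a b c]
  simp_rw [integral_finsetSum _ fun b _ => integrable_finsetSum _ fun c _ => hi' _ b c,
    integral_finsetSum _ fun c _ => hi' _ _ c]
  rw [pow_succ, pow_two]
  simp only [smoothSum, Finset.sum_mul]
  simp only [Finset.mul_sum, Finset.sum_mul]
  refine Finset.sum_congr rfl fun a _ => Finset.sum_congr rfl fun b _ =>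
    Finset.sum_congr rfl fun c _ => ?_
  have := h1 (ρ (Real.log a - L) * ρ (Real.log b - L) * ρ (Real.log c - L) : ℝ)
      (Real.log a + Real.log b + Real.log c)
  simp only [← ofReal_mul] at this
  rw [this, show -(t * (Real.log a + Real.log b + Real.log c)) =
    -(t * Real.log a) + -(t * Real.log b) + -(t * Real.log c) by ring,
    AddChar.map_add_eq_mul, AddChar.map_add_eq_mul]
  push_cast
  ring

/-! ### Difference kernels and Plancherel. -/

/-- The `L¹`-normalised dilate of `φ` to scale `δ`. -/
noncomputable def dilate (φ : ℝ → ℝ) (δ u : ℝ) : ℝ := δ⁻¹ * φ (u / δ)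

theorem contDiff_dilate {φ : ℝ → ℝ} (hφ : ContDiff ℝ ∞ φ) (δ : ℝ) : ContDiff ℝ ∞ (dilate φ δ) :=
  contDiff_const.mul (hφ.comp (contDiff_id.div_const δ))

theorem hasCompactSupport_dilate {φ : ℝ → ℝ} (hφ : HasCompactSupport φ) {δ : ℝ} (hδ : 0 < δ) :
    HasCompactSupport (dilate φ δ) :=
  HasCompactSupport.mul_left (by
    simpa [Function.comp_def, div_eq_mul_inv] using
      hφ.comp_homeomorph (Homeomorph.mulRight₀ δ⁻¹ (inv_ne_zero hδ.ne')))

theorem fourier_dilate (φ : ℝ → ℝ) {δ : ℝ} (hδ : 0 < δ) (t : ℝ) :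
    𝓕 (fun u => (dilate φ δ u : ℂ)) t = 𝓕 (fun u => (φ u : ℂ)) (δ * t) := by
  rw [Real.fourier_real_eq, Real.fourier_real_eq]
  have h := Measure.integral_comp_div (fun v => 𝐞 (-(v * (δ * t))) • (φ v : ℂ)) δ
  rw [abs_of_pos hδ] at h
  have h2 : ∫ v, 𝐞 (-(v * t)) • (dilate φ δ v : ℂ) =
      (δ⁻¹ : ℂ) * ∫ x, 𝐞 (-(x / δ * (δ * t))) • (φ (x / δ) : ℂ) := by
    rw [← integral_const_mul]
    refine integral_congr_ae (Eventually.of_forall fun u => ?_)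
    simp only [Circle.smul_def, smul_eq_mul, dilate, show u / δ * (δ * t) = u * t by field_simp]
    push_cast
    ring
  rw [h2, h, real_smul, ← mul_assoc, inv_mul_cancel₀ (by exact_mod_cast hδ.ne'), one_mul]

/-- The transform is `φ̂(δt) - φ̂(δ't)`. The first bound is the Lipschitz property of `φ̂`, giving
cancellation near `t = 0`; the second is the decay of `φ̂`, where the finer scale is the worse one.
-/
theorem exists_norm_fourier_dilate_sub_le {φ : ℝ → ℝ} (hφ : ContDiff ℝ ∞ φ)
    (hc : HasCompactSupport φ) :
    ∃ K : ℝ, 0 < K ∧ ∀ δ δ' : ℝ, 0 < δ → δ ≤ δ' → ∀ t : ℝ,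
      ‖𝓕 (fun u => ((dilate φ δ u - dilate φ δ' u : ℝ) : ℂ)) t‖ ≤ K * (δ' * |t|) ∧
      ‖𝓕 (fun u => ((dilate φ δ u - dilate φ δ' u : ℝ) : ℂ)) t‖ ≤ K * (1 + δ * |t|)⁻¹ := by
  have hφc : HasCompactSupport fun u => (φ u : ℂ) := hc.comp_left ofReal_zero
  let f := hφc.toSchwartzMap (ofRealCLM.contDiff.comp hφ)
  let g : SchwartzMap ℝ ℂ := 𝓕 f
  have hg : ∀ x, g x = 𝓕 (fun u => (φ u : ℂ)) x := fun x => rfl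
  obtain ⟨K1, hK1, h1⟩ := g.exists_norm_le_one_add_abs_pow 1
  obtain ⟨K2, hK2, h2⟩ := (SchwartzMap.derivCLM ℂ ℂ g).exists_norm_le_one_add_abs_pow 0
  refine ⟨2 * K1 + K2, by positivity, fun δ δ' hδ hδ' t => ?_⟩
  have hδ'0 := hδ.trans_le hδ'
  have hi : ∀ d : ℝ, 0 < d → Integrable fun v => 𝐞 (-(v * t)) • (dilate φ d v : ℂ) := by
    intro d hd
    have h : Integrable fun u => (dilate φ d u : ℂ) :=
      ((contDiff_dilate hφ d).continuous.integrable_of_hasCompactSupport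
        (hasCompactSupport_dilate hc hd)).ofReal
    simpa [mul_comm] using (Real.fourierIntegral_convergent_iff t).2 h
  have he : 𝓕 (fun u => ((dilate φ δ u - dilate φ δ' u : ℝ) : ℂ)) t = g (δ * t) - g (δ' * t) := by
    rw [hg, hg, ← fourier_dilate φ hδ, ← fourier_dilate φ hδ'0]
    simp only [Real.fourier_real_eq]
    rw [← integral_sub (hi δ hδ) (hi δ' hδ'0)]
    simp only [ofReal_sub, smul_sub]
  rw [he]
  constructor
  · have h := Convex.norm_image_sub_le_of_norm_deriv_le (f := g) (s := univ) (C := K2)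
      (x := δ' * t) (y := δ * t) (fun x _ => g.differentiableAt)
      (fun x _ => by simpa using h2 x) convex_univ (mem_univ _) (mem_univ _)
    refine h.trans ?_
    have : ‖δ * t - δ' * t‖ ≤ δ' * |t| := by
      rw [← sub_mul, norm_mul, Real.norm_eq_abs, Real.norm_eq_abs]
      gcongr
      rw [abs_le]; constructor <;> linarith
    have h3 : 0 ≤ δ' * |t| := by positivity
    nlinarith
  · have ha : ‖g (δ * t)‖ ≤ K1 * (1 + δ * |t|)⁻¹ := by
      simpa [abs_mul, abs_of_pos hδ] using h1 (δ * t)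
    have hb : ‖g (δ' * t)‖ ≤ K1 * (1 + δ * |t|)⁻¹ := by
      have : ‖g (δ' * t)‖ ≤ K1 * (1 + δ' * |t|)⁻¹ := by
        simpa [abs_mul, abs_of_pos hδ'0] using h1 (δ' * t)
      refine this.trans ?_
      gcongr
    have h3 : 0 ≤ (1 + δ * |t|)⁻¹ := by positivity
    refine (norm_sub_le _ _).trans ?_
    nlinarith

theorem integral_sq_tripleSum (ρ : ℝ → ℝ) (L : ℝ) (M : ℕ) {κ : ℝ → ℝ} (hκ : ContDiff ℝ ∞ κ)
    (hc : HasCompactSupport κ) :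
    ∫ u, tripleSum ρ L M κ u ^ 2 =
      ∫ t, ‖smoothSum ρ L M t‖ ^ 6 * ‖𝓕 (fun u => (κ u : ℂ)) t‖ ^ 2 := by
  have hcc : HasCompactSupport fun u => (tripleSum ρ L M κ u : ℂ) :=
    (hasCompactSupport_tripleSum ρ L M hc).comp_left (g := ((↑) : ℝ → ℂ)) ofReal_zero
  let f := hcc.toSchwartzMap (ofRealCLM.contDiff.comp (contDiff_tripleSum ρ L M hκ))
  have h := SchwartzMap.integral_norm_sq_fourier f
  have h1 : ∀ t, (𝓕 f : SchwartzMap ℝ ℂ) t =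
      smoothSum ρ L M t ^ 3 * 𝓕 (fun u => (κ u : ℂ)) t := fun t => by
    rw [SchwartzMap.fourier_coe,
      ← fourier_tripleSum ρ L M (hκ.continuous.integrable_of_hasCompactSupport hc) t]
    rfl
  have h2 : ∀ u, f u = (tripleSum ρ L M κ u : ℂ) := fun u => rfl
  simp only [h1, h2, Complex.norm_real, norm_mul, norm_pow, Real.norm_eq_abs, sq_abs] at h
  rw [← h]
  refine integral_congr_ae (Eventually.of_forall fun u => ?_)
  simp only
  ring

/-! ### The second moment of the difference. -/

theorem integral_one_add_mul_abs_rpow (r : ℝ) {δ : ℝ} (hδ : 0 < δ) :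
    ∫ t : ℝ, (1 + δ * |t|) ^ r = δ⁻¹ * ∫ x : ℝ, (1 + |x|) ^ r := by
  have h := Measure.integral_comp_mul_left (fun x : ℝ => (1 + |x|) ^ r) δ
  simpa [abs_mul, abs_of_pos hδ] using h

theorem integrable_one_add_mul_abs_rpow {r : ℝ} (hr : 1 < r) {δ : ℝ} (hδ : 0 < δ) :
    Integrable fun t : ℝ => (1 + δ * |t|) ^ (-r) := by
  have h := (integrable_one_add_abs_rpow hr).comp_mul_left' hδ.ne'
  simpa [abs_mul, abs_of_pos hδ] using h

theorem main_range_le {N t δ' : ℝ} :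
    (N * (1 + |t|)⁻¹) ^ 6 * (δ' * |t|) ^ 2 ≤ N ^ 6 * δ' ^ 2 * (1 + |t|) ^ (-2 : ℝ) := by
  have h0 : 0 < 1 + |t| := by positivity
  have h1 : (1 + |t|)⁻¹ ^ 6 * |t| ^ 2 ≤ ((1 + |t|) ^ 2)⁻¹ := by
    rw [inv_pow, inv_mul_le_iff₀ (by positivity), ← div_eq_mul_inv, le_div_iff₀ (by positivity),
      ← mul_pow]
    calc (|t| * (1 + |t|)) ^ 2 ≤ ((1 + |t|) * (1 + |t|)) ^ 2 := by gcongr; linarith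
      _ = (1 + |t|) ^ 4 := by ring
      _ ≤ (1 + |t|) ^ 6 := pow_le_pow_right₀ (by linarith [abs_nonneg t]) (by norm_num)
  have e : (1 + |t|) ^ (-2 : ℝ) = ((1 + |t|) ^ 2)⁻¹ := by
    rw [Real.rpow_neg h0.le]; norm_cast
  rw [e, mul_pow, mul_pow]
  calc _ = N ^ 6 * δ' ^ 2 * ((1 + |t|)⁻¹ ^ 6 * |t| ^ 2) := by ring
    _ ≤ _ := by gcongr

/-- Since `1+|t| ≤ δ⁻¹(1+δ|t|)`, the growth `(1+|t|)^(6η)` costs `δ^(-6η)`; `η ≤ 1/12` leaves the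
integrable exponent `-3/2`. -/
theorem error_range_le {B t δ η : ℝ} (hδ : 0 < δ) (hδ1 : δ ≤ 1) (hη : 0 < η) (hη1 : η ≤ 1 / 12) :
    (B * (1 + |t|) ^ η) ^ 6 * ((1 + δ * |t|)⁻¹) ^ 2 ≤
      B ^ 6 * δ ^ (-(6 * η)) * (1 + δ * |t|) ^ (-(3 / 2) : ℝ) := by
  have h0 : 0 < 1 + |t| := by positivity
  have h1 : 1 ≤ 1 + δ * |t| := by have : 0 ≤ δ * |t| := by positivity
                                  linarith
  have e1 : ((1 + |t|) ^ η) ^ 6 = (1 + |t|) ^ (6 * η) := by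
    rw [← Real.rpow_natCast, ← Real.rpow_mul h0.le]; ring_nf
  have e2 : ((1 + δ * |t|)⁻¹) ^ 2 = (1 + δ * |t|) ^ (-2 : ℝ) := by
    rw [Real.rpow_neg (by linarith), inv_pow]; norm_cast
  have e3 : (1 + |t|) ^ (6 * η) ≤ δ ^ (-(6 * η)) * (1 + δ * |t|) ^ (6 * η) := by
    rw [Real.rpow_neg hδ.le, ← Real.inv_rpow hδ.le, ← Real.mul_rpow (by positivity) (by linarith)]
    refine Real.rpow_le_rpow h0.le ?_ (by positivity)
    rw [mul_add, ← mul_assoc, inv_mul_cancel₀ hδ.ne', mul_one, one_mul]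
    linarith [(one_le_inv₀ hδ).2 hδ1]
  rw [mul_pow, e1, e2, mul_assoc, mul_assoc]
  refine mul_le_mul_of_nonneg_left ?_ (by positivity)
  calc _ ≤ δ ^ (-(6 * η)) * (1 + δ * |t|) ^ (6 * η) * (1 + δ * |t|) ^ (-2 : ℝ) := by gcongr
    _ = δ ^ (-(6 * η)) * (1 + δ * |t|) ^ (6 * η + -2) := by
      rw [mul_assoc, ← Real.rpow_add (by linarith)]
    _ ≤ _ := by
      gcongr
      linarith

theorem exists_integral_sq_tripleSum_le (hL : LindelofHypothesis) {ρ φ : ℝ → ℝ}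
    (hρ : ContDiff ℝ ∞ ρ) (hρc : HasCompactSupport ρ) (hφ : ContDiff ℝ ∞ φ)
    (hφc : HasCompactSupport φ) {η : ℝ} (hη : 0 < η) (hη1 : η ≤ 1 / 12) :
    ∃ C : ℝ, 0 < C ∧ ∀ (L : ℝ) (M : ℕ), 0 < M → (∀ u, Real.log M < u → ρ (u - L) = 0) →
      ∀ δ δ' : ℝ, 0 < δ → δ ≤ δ' → δ ≤ 1 →
      ∫ u, tripleSum ρ L M (fun v => dilate φ δ v - dilate φ δ' v) u ^ 2 ≤
        C * (Real.exp (6 * L) * δ' ^ 2 + Real.exp (3 * L) * δ ^ (-1 - 6 * η)) := by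
  obtain ⟨C, hC, hF⟩ := exists_norm_smoothSum_le hL hρ hρc hη (hη1.trans (by norm_num))
  obtain ⟨K, hK, hψ⟩ := exists_norm_fourier_dilate_sub_le hφ hφc
  set J := ∫ x : ℝ, (1 + |x|) ^ (-2 : ℝ) with hJ
  set J' := ∫ x : ℝ, (1 + |x|) ^ (-(3 / 2) : ℝ) with hJ'
  have hJ0 : 0 ≤ J := integral_nonneg fun x => by positivity
  have hJ0' : 0 ≤ J' := integral_nonneg fun x => by positivity
  refine ⟨32 * C ^ 6 * K ^ 2 * (J + J' + 1), by positivity, fun L M hM0 hM δ δ' hδ hδ' hδ1 => ?_⟩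
  rw [integral_sq_tripleSum ρ L M ((contDiff_dilate hφ δ).sub (contDiff_dilate hφ δ'))
    ((hasCompactSupport_dilate hφc hδ).sub (hasCompactSupport_dilate hφc (hδ.trans_le hδ')))]
  set A := Real.exp (6 * L) * δ' ^ 2 with hA
  set B := Real.exp (3 * L) * δ ^ (-(6 * η)) with hB
  have hA0 : 0 ≤ A := by positivity
  have hB0 : 0 ≤ B := by positivity
  have hint : Integrable fun t : ℝ => 32 * C ^ 6 * K ^ 2 *
      (A * (1 + |t|) ^ (-2 : ℝ) + B * (1 + δ * |t|) ^ (-(3 / 2) : ℝ)) :=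
    (((integrable_one_add_abs_rpow one_lt_two).const_mul A).add
      ((integrable_one_add_mul_abs_rpow (by norm_num) hδ).const_mul B)).const_mul _
  refine (integral_mono_of_nonneg (Eventually.of_forall fun t => by positivity) hint
    (Eventually.of_forall fun t => ?_)).trans ?_
  · have h1 := hF L M hM0 hM t
    obtain ⟨h2, h3⟩ := hψ δ δ' hδ hδ' t
    simp only
    set Y := ‖𝓕 (fun u => ((dilate φ δ u - dilate φ δ' u : ℝ) : ℂ)) t‖
    set a := Real.exp L * (1 + |t|)⁻¹ with ha
    set b := Real.exp (L / 2) * (1 + |t|) ^ η with hb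
    have ha0 : 0 ≤ a := by positivity
    have hb0 : 0 ≤ b := by positivity
    have hY0 : 0 ≤ Y := norm_nonneg _
    have e1 : (a + b) ^ 6 ≤ 32 * (a ^ 6 + b ^ 6) := by
      have := add_pow_le ha0 hb0 6
      norm_num at this
      exact this
    have hma := main_range_le (N := Real.exp L) (t := t) (δ' := δ')
    have her := error_range_le (B := Real.exp (L / 2)) (t := t) hδ hδ1 hη hη1
    rw [← Real.exp_nat_mul] at hma her
    rw [show ((6 : ℕ) : ℝ) * L = 6 * L by norm_num] at hma
    rw [show ((6 : ℕ) : ℝ) * (L / 2) = 3 * L by push_cast; ring] at her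
    calc ‖smoothSum ρ L M t‖ ^ 6 * Y ^ 2 ≤ (C * (a + b)) ^ 6 * Y ^ 2 := by gcongr
      _ = C ^ 6 * ((a + b) ^ 6 * Y ^ 2) := by ring
      _ ≤ C ^ 6 * (32 * (a ^ 6 + b ^ 6) * Y ^ 2) := by gcongr
      _ = 32 * C ^ 6 * (a ^ 6 * Y ^ 2 + b ^ 6 * Y ^ 2) := by ring
      _ ≤ 32 * C ^ 6 * (a ^ 6 * (K * (δ' * |t|)) ^ 2 + b ^ 6 * (K * (1 + δ * |t|)⁻¹) ^ 2) := by
        gcongr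
      _ = 32 * C ^ 6 * K ^ 2 * (a ^ 6 * (δ' * |t|) ^ 2 + b ^ 6 * ((1 + δ * |t|)⁻¹) ^ 2) := by ring
      _ ≤ _ := by gcongr
  · rw [integral_const_mul, integral_add ((integrable_one_add_abs_rpow one_lt_two).const_mul A)
      ((integrable_one_add_mul_abs_rpow (by norm_num) hδ).const_mul B), integral_const_mul,
      integral_const_mul, integral_one_add_mul_abs_rpow _ hδ, ← hJ, ← hJ']
    have e : δ ^ (-1 - 6 * η) = δ ^ (-(6 * η)) * δ⁻¹ := by
      rw [← Real.rpow_neg_one, ← Real.rpow_add hδ]; ring_nf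
    rw [e, ← mul_assoc (Real.exp (3 * L)), ← hB, mul_assoc _ (J + J' + 1)]
    refine mul_le_mul_of_nonneg_left ?_ (by positivity)
    have h1 : 0 ≤ B * δ⁻¹ := by positivity
    nlinarith [mul_nonneg hA0 hJ0', mul_nonneg h1 hJ0]

/-! ### The lower bound at the coarse scale. -/

/-- The interval `[exp v, exp(v+θ)]` has length at least `exp v * θ ≥ 2`, so losing one integer at
the ends costs at most half of the count. -/
theorem le_sum_of_log_mem {M : ℕ} {f : ℕ → ℝ} (hf : ∀ n ∈ Finset.Icc 1 M, 0 ≤ f n) {v θ m : ℝ}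
    (hm : 0 ≤ m) (hθ : 2 ≤ Real.exp v * θ) (hv : Real.exp (v + θ) ≤ M)
    (h : ∀ n : ℕ, 1 ≤ n → v ≤ Real.log n → Real.log n ≤ v + θ → m ≤ f n) :
    m * (Real.exp v * θ / 2) ≤ ∑ n ∈ Finset.Icc 1 M, f n := by
  have hsub : Finset.Icc ⌈Real.exp v⌉₊ ⌊Real.exp (v + θ)⌋₊ ⊆ Finset.Icc 1 M :=
    Finset.Icc_subset_Icc (Nat.one_le_ceil_iff.2 (Real.exp_pos v)) (Nat.floor_le_of_le hv)
  have hcard : Real.exp v * θ / 2 ≤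
      ((Finset.Icc ⌈Real.exp v⌉₊ ⌊Real.exp (v + θ)⌋₊).card : ℝ) := by
    rw [Nat.card_Icc]
    have h1 : ((⌊Real.exp (v + θ)⌋₊ + 1 : ℕ) : ℝ) ≤
        ((⌊Real.exp (v + θ)⌋₊ + 1 - ⌈Real.exp v⌉₊ : ℕ) : ℝ) + (⌈Real.exp v⌉₊ : ℝ) := by
      rw [← Nat.cast_add]
      exact_mod_cast le_tsub_add
    have h2 := Nat.ceil_lt_add_one (Real.exp_pos v).le
    have h3 := Nat.lt_floor_add_one (Real.exp (v + θ))
    have h4 : Real.exp v * (1 + θ) ≤ Real.exp (v + θ) := by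
      rw [Real.exp_add]
      gcongr
      linarith [Real.add_one_le_exp θ]
    push_cast at h1
    nlinarith
  refine le_trans ?_ (Finset.sum_le_sum_of_subset_of_nonneg hsub fun n hn _ => hf n hn)
  calc m * (Real.exp v * θ / 2) ≤
        m * ((Finset.Icc ⌈Real.exp v⌉₊ ⌊Real.exp (v + θ)⌋₊).card : ℝ) := by gcongr
    _ = ∑ n ∈ Finset.Icc ⌈Real.exp v⌉₊ ⌊Real.exp (v + θ)⌋₊, m := by
      rw [Finset.sum_const, nsmul_eq_mul, mul_comm]
    _ ≤ _ := by
      refine Finset.sum_le_sum fun n hn => ?_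
      have hn1 := (Finset.mem_Icc.1 (hsub hn)).1
      have hn0 : (0 : ℝ) < n := by exact_mod_cast hn1
      obtain ⟨ha, hb⟩ := Finset.mem_Icc.1 hn
      refine h n hn1 ?_ ?_
      · rw [Real.le_log_iff_exp_le hn0]; exact Nat.ceil_le.1 ha
      · rw [Real.log_le_iff_le_exp hn0]; exact (Nat.le_floor_iff (Real.exp_pos _).le).1 hb

/-- Choose `a`, `b` freely just above `exp(u/3)`; then `c` runs over an interval of logarithmic
length `δ/2`, whose count of order `exp L * δ` cancels the normalisation `δ⁻¹`. The condition `8 ≤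
exp L * δ` makes that interval long enough to count integers, and `δ ≤ log 2 / 9` keeps `log c - L`
in the window where `ρ = 1`. -/
theorem le_tripleSum_dilate {ρ φ : ℝ → ℝ} (hρ0 : ∀ x, 0 ≤ ρ x) (hφ0 : ∀ x, 0 ≤ φ x)
    (hρ1 : ∀ x, -(Real.log 2 / 12) ≤ x → x ≤ 5 * Real.log 2 / 12 → ρ x = 1)
    (hφ1 : ∀ x, -(3 / 4) ≤ x → x ≤ -(1 / 4) → φ x = 1)
    {L : ℝ} {M : ℕ} (hM : 2 * Real.exp L ≤ M) {δ u : ℝ} (hδ : 0 < δ) (hδ1 : δ ≤ Real.log 2 / 9)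
    (hδL : 8 ≤ Real.exp L * δ) (hLL : 2 ≤ Real.exp L * (Real.log 2 / 24))
    (hu1 : 3 * L ≤ u) (hu2 : u ≤ 3 * L + Real.log 2) :
    Real.exp (3 * L) * ((Real.log 2 / 24) ^ 2 / 32) ≤ tripleSum ρ L M (dilate φ δ) u := by
  set l := Real.log 2 with hl
  have hl0 : 0 < l := Real.log_pos one_lt_two
  have hE := Real.exp_pos L
  have hMle : ∀ w, w ≤ L + l → Real.exp w ≤ M := fun w hw => by
    refine le_trans ?_ hM
    rw [← Real.exp_log (show (0 : ℝ) < 2 by norm_num), ← Real.exp_add]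
    exact Real.exp_le_exp.2 (by linarith)
  have hterm0 : ∀ a b c : ℕ, 0 ≤ ρ (Real.log a - L) * ρ (Real.log b - L) * ρ (Real.log c - L) *
      dilate φ δ (u - (Real.log a + Real.log b + Real.log c)) := fun a b c =>
    mul_nonneg (mul_nonneg (mul_nonneg (hρ0 _) (hρ0 _)) (hρ0 _))
      (mul_nonneg (inv_nonneg.2 hδ.le) (hφ0 _))
  have hinner : ∀ a b : ℕ, u / 3 ≤ Real.log a → Real.log a ≤ u / 3 + l / 24 →
      u / 3 ≤ Real.log b → Real.log b ≤ u / 3 + l / 24 →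
      Real.exp L / 8 ≤ ∑ c ∈ Finset.Icc 1 M,
        ρ (Real.log a - L) * ρ (Real.log b - L) * ρ (Real.log c - L) *
          dilate φ δ (u - (Real.log a + Real.log b + Real.log c)) := by
    intro a b ha1 ha2 hb1 hb2
    have hev : Real.exp L / 2 ≤ Real.exp (u - Real.log a - Real.log b + δ / 4) := by
      rw [div_le_iff₀ (by norm_num), ← Real.exp_log (show (0 : ℝ) < 2 by norm_num), ← Real.exp_add]
      exact Real.exp_le_exp.2 (by linarith)
    have := le_sum_of_log_mem (M := M) (m := δ⁻¹) (v := u - Real.log a - Real.log b + δ / 4)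
      (θ := δ / 2) (fun c _ => hterm0 a b c) (inv_nonneg.2 hδ.le) (by nlinarith)
      (hMle _ (by linarith)) (fun c _ hc1 hc2 => by
        rw [hρ1 _ (by linarith) (by linarith), hρ1 _ (by linarith) (by linarith),
          hρ1 _ (by linarith) (by linarith), dilate, hφ1]
        · simp
        · rw [le_div_iff₀ hδ]; linarith
        · rw [div_le_iff₀ hδ]; linarith)
    refine le_trans ?_ this
    calc Real.exp L / 8 = δ⁻¹ * (Real.exp L / 2 * (δ / 2) / 2) := by field_simp; norm_num
      _ ≤ _ := by gcongr
  have heu : Real.exp L ≤ Real.exp (u / 3) := Real.exp_le_exp.2 (by linarith)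
  have h24 : 2 ≤ Real.exp (u / 3) * (l / 24) := hLL.trans (by gcongr)
  have hmid : ∀ a : ℕ, u / 3 ≤ Real.log a → Real.log a ≤ u / 3 + l / 24 →
      Real.exp L / 8 * (Real.exp L * (l / 24) / 2) ≤
      ∑ b ∈ Finset.Icc 1 M, ∑ c ∈ Finset.Icc 1 M,
        ρ (Real.log a - L) * ρ (Real.log b - L) * ρ (Real.log c - L) *
          dilate φ δ (u - (Real.log a + Real.log b + Real.log c)) := by
    intro a ha1 ha2
    have := le_sum_of_log_mem (M := M) (m := Real.exp L / 8) (v := u / 3) (θ := l / 24)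
      (fun b _ => Finset.sum_nonneg fun c _ => hterm0 a b c) (by positivity) h24
      (hMle _ (by linarith)) (fun b _ hb1 hb2 => hinner a b ha1 ha2 hb1 hb2)
    refine le_trans ?_ this
    gcongr
  have hout := le_sum_of_log_mem (M := M) (m := Real.exp L / 8 * (Real.exp L * (l / 24) / 2))
    (v := u / 3) (θ := l / 24)
    (fun a _ => Finset.sum_nonneg fun b _ => Finset.sum_nonneg fun c _ => hterm0 a b c)
    (by positivity) h24 (hMle _ (by linarith)) (fun a _ ha1 ha2 => hmid a ha1 ha2)
  refine le_trans ?_ hout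
  have e3 : Real.exp (3 * L) = Real.exp L ^ 3 := by rw [← Real.exp_nat_mul]; norm_num
  calc _ = Real.exp L / 8 * (Real.exp L * (l / 24) / 2) * (Real.exp L * (l / 24) / 2) := by
        rw [e3]; ring
    _ ≤ _ := by gcongr

/-! ### From logarithmic coordinates to almost cubes. -/

/-- Each factor has logarithm within `2 log 2 / 3` of `log x / 3`, which gives the factors `1/2` and
`2`; the constants `1/4` and `4` absorb the change from `x` to `n`. -/
theorem hasNearbyAlmostCube_of_log {ε x L δ : ℝ} {a b c : ℕ} (hx : 0 < x)
    (ha : 0 < a) (hb : 0 < b) (hc : 0 < c)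
    (hx1 : 3 * L ≤ Real.log x) (hx2 : Real.log x ≤ 3 * L + Real.log 2)
    (hδ : δ ≤ 1 / 2) (hδx : x * Real.exp δ ≤ x + x ^ ε)
    (hal : |Real.log a - L - Real.log 2 / 6| ≤ Real.log 2 / 2)
    (hbl : |Real.log b - L - Real.log 2 / 6| ≤ Real.log 2 / 2)
    (hcl : |Real.log c - L - Real.log 2 / 6| ≤ Real.log 2 / 2)
    (h1 : Real.log x ≤ Real.log a + Real.log b + Real.log c)
    (h2 : Real.log a + Real.log b + Real.log c ≤ Real.log x + δ) :
    HasNearbyAlmostCube (1 / 4) 4 ε x := by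
  have hl0 : 1 / 2 < Real.log 2 := by linarith [Real.log_two_gt_d9]
  have ha' : (0 : ℝ) < a := by exact_mod_cast ha
  have hb' : (0 : ℝ) < b := by exact_mod_cast hb
  have hc' : (0 : ℝ) < c := by exact_mod_cast hc
  have hn' : (0 : ℝ) < (a : ℝ) * b * c := by positivity
  have hlog : Real.log ((a : ℝ) * b * c) = Real.log a + Real.log b + Real.log c := by
    rw [Real.log_mul (by positivity) (by positivity), Real.log_mul (by positivity) (by positivity)]
  have hlog4 : Real.log 4 = 2 * Real.log 2 := by
    rw [show (4 : ℝ) = 2 ^ 2 by norm_num, Real.log_pow]; norm_num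
  have hsize : ∀ m : ℕ, 0 < m → |Real.log m - L - Real.log 2 / 6| ≤ Real.log 2 / 2 →
      (1 / 4 * ((a : ℝ) * b * c) ^ (1 / 3 : ℝ) ≤ m ∧ (m : ℝ) ≤ 4 * ((a : ℝ) * b * c) ^ (1 / 3 : ℝ)) ∧
      (x ^ (1 / 3 : ℝ) / 2 ≤ m ∧ (m : ℝ) ≤ 2 * x ^ (1 / 3 : ℝ)) := by
    intro m hm hml
    have hm' : (0 : ℝ) < m := by exact_mod_cast hm
    have hnp := Real.rpow_pos_of_pos hn' (1 / 3)
    have hxp := Real.rpow_pos_of_pos hx (1 / 3)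
    obtain ⟨hm1, hm2⟩ := abs_le.1 hml
    refine ⟨⟨?_, ?_⟩, ?_, ?_⟩
    · rw [← Real.log_le_log_iff (by positivity) hm', Real.log_mul (by norm_num) hnp.ne',
        Real.log_rpow hn', hlog, one_div, Real.log_inv, hlog4]
      linarith
    · rw [← Real.log_le_log_iff hm' (by positivity), Real.log_mul (by norm_num) hnp.ne',
        Real.log_rpow hn', hlog, hlog4]
      linarith
    · rw [← Real.log_le_log_iff (by positivity) hm', Real.log_div hxp.ne' (by norm_num),
        Real.log_rpow hx]
      linarith
    · rw [← Real.log_le_log_iff hm' (by positivity), Real.log_mul (by norm_num) hxp.ne',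
        Real.log_rpow hx]
      linarith
  have hall : ∀ i, 0 < ![a, b, c] i ∧
      |Real.log (![a, b, c] i) - L - Real.log 2 / 6| ≤ Real.log 2 / 2 := by
    intro i
    fin_cases i
    · exact ⟨ha, hal⟩
    · exact ⟨hb, hbl⟩
    · exact ⟨hc, hcl⟩
  refine ⟨a * b * c, ![a, b, c], ⟨by positivity, by simp [Fin.prod_univ_three], fun i => ?_⟩,
    ?_, fun i => (hsize _ (hall i).1 (hall i).2).2⟩
  · have := (hsize _ (hall i).1 (hall i).2).1
    push_cast
    exact this
  · push_cast
    constructor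
    · rwa [← Real.log_le_log_iff hx hn', hlog]
    · refine le_trans ?_ hδx
      rwa [← Real.log_le_log_iff hn' (by positivity), Real.log_mul hx.ne' (Real.exp_pos _).ne',
        Real.log_exp, hlog]

/-! ### Chebyshev's inequality and the bump functions. -/

/-- Chebyshev in the variable `u`, carried to `x = exp u`, whose derivative is at most `2X` on the
relevant range. Measurability of `S` is avoided by enclosing it in the image of `T`. -/
theorem volume_real_le_of_exp {X V : ℝ} (hX : 0 < X) {S : Set ℝ} {D : ℝ → ℝ} (hD : Continuous D)
    (hDi : Integrable fun u => D u ^ 2) (hV : 0 < V)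
    (hS : ∀ x ∈ S, x ∈ Icc X (2 * X) ∧ V ≤ |D (Real.log x)|) :
    volume.real S ≤ 2 * X * ((∫ u, D u ^ 2) / V ^ 2) := by
  set T : Set ℝ := {u | V ^ 2 ≤ D u ^ 2} ∩ Iic (Real.log (2 * X)) with hT
  have hTm : MeasurableSet T :=
    (measurableSet_le measurable_const (hD.pow 2).measurable).inter measurableSet_Iic
  have hch := mul_meas_ge_le_integral_of_nonneg (μ := volume) (f := fun u => D u ^ 2)
    (Eventually.of_forall fun u => sq_nonneg _) hDi (V ^ 2)
  have hfin : volume {u | V ^ 2 ≤ D u ^ 2} ≠ ⊤ := by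
    exact (hDi.measure_ge_lt_top (by positivity)).ne
  have hTfin : volume T ≠ ⊤ := measure_ne_top_of_subset inter_subset_left hfin
  have hsub : S ⊆ Real.exp '' T := by
    intro x hx
    obtain ⟨⟨h1, h2⟩, h3⟩ := hS x hx
    have hx0 : 0 < x := hX.trans_le h1
    refine ⟨Real.log x, ⟨?_, Real.log_le_log hx0 h2⟩, Real.exp_log hx0⟩
    change V ^ 2 ≤ D (Real.log x) ^ 2
    rw [← sq_abs (D _)]
    gcongr
  have himg : volume (Real.exp '' T) ≤ ENNReal.ofReal (2 * X) * volume T := by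
    have h := lintegral_image_eq_lintegral_abs_deriv_mul hTm
      (fun u _ => (Real.hasDerivAt_exp u).hasDerivWithinAt) Real.exp_injective.injOn (fun _ => 1)
    rw [lintegral_one, Measure.restrict_apply_univ] at h
    rw [h, ← setLIntegral_const]
    refine setLIntegral_mono measurable_const fun u hu => ?_
    rw [mul_one, abs_of_pos (Real.exp_pos u)]
    refine ENNReal.ofReal_le_ofReal ?_
    rw [← Real.exp_log (show 0 < 2 * X by positivity)]
    exact Real.exp_le_exp.2 hu.2
  have h1 : volume.real S ≤ 2 * X * volume.real T := by
    have := (measure_mono hsub).trans himg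
    rw [Measure.real, Measure.real, ← ENNReal.toReal_ofReal (show 0 ≤ 2 * X by positivity),
      ← ENNReal.toReal_mul]
    exact ENNReal.toReal_mono (ENNReal.mul_ne_top ENNReal.ofReal_ne_top hTfin) this
  refine h1.trans ?_
  gcongr
  rw [le_div_iff₀ (by positivity), mul_comm]
  refine le_trans ?_ hch
  gcongr
  exact inter_subset_left

/-- The bump function weighting the factors in logarithmic coordinates. -/
noncomputable def factorBump : ContDiffBump (Real.log 2 / 6 : ℝ) where
  rIn := Real.log 2 / 4
  rOut := Real.log 2 / 2
  rIn_pos := by have := Real.log_pos one_lt_two; positivity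
  rIn_lt_rOut := by linarith [Real.log_pos one_lt_two]

/-- The bump function detecting products just to the right of a point. -/
noncomputable def shortBump : ContDiffBump (-(1 / 2) : ℝ) where
  rIn := 1 / 4
  rOut := 1 / 2
  rIn_pos := by norm_num
  rIn_lt_rOut := by norm_num

theorem abs_sub_le_of_factorBump_ne_zero {x : ℝ} (h : factorBump x ≠ 0) :
    |x - Real.log 2 / 6| ≤ Real.log 2 / 2 := by
  contrapose! h
  exact factorBump.zero_of_le_dist (by rw [Real.dist_eq]; exact h.le)

theorem factorBump_eq_one {x : ℝ} (h1 : -(Real.log 2 / 12) ≤ x) (h2 : x ≤ 5 * Real.log 2 / 12) :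
    factorBump x = 1 := by
  refine factorBump.one_of_mem_closedBall ?_
  rw [Metric.mem_closedBall, Real.dist_eq, abs_le]
  change -(Real.log 2 / 4) ≤ _ ∧ _ ≤ Real.log 2 / 4
  constructor <;> linarith

theorem shortBump_eq_one {x : ℝ} (h1 : -(3 / 4) ≤ x) (h2 : x ≤ -(1 / 4)) : shortBump x = 1 := by
  refine shortBump.one_of_mem_closedBall ?_
  rw [Metric.mem_closedBall, Real.dist_eq, abs_le]
  change -(1 / 4) ≤ _ ∧ _ ≤ 1 / 4
  constructor <;> linarith

theorem mem_Icc_of_shortBump_ne_zero {x : ℝ} (h : shortBump x ≠ 0) : x ∈ Icc (-1) 0 := by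
  have : |x - -(1 / 2)| ≤ 1 / 2 := by
    contrapose! h
    exact shortBump.zero_of_le_dist (by rw [Real.dist_eq]; exact h.le)
  rw [abs_le] at this
  constructor <;> linarith

/-- A nonzero term would produce an almost cube: the support `[-1, 0]` of `shortBump` forces `log x
≤ log(abc) ≤ log x + δ`. -/
theorem tripleSum_eq_zero_of_not_hasNearbyAlmostCube {ε x L δ : ℝ} {M : ℕ} (hx : 0 < x)
    (hx1 : 3 * L ≤ Real.log x) (hx2 : Real.log x ≤ 3 * L + Real.log 2)
    (hδ0 : 0 < δ) (hδ : δ ≤ 1 / 2) (hδx : x * Real.exp δ ≤ x + x ^ ε)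
    (h : ¬ HasNearbyAlmostCube (1 / 4) 4 ε x) :
    tripleSum factorBump L M (dilate shortBump δ) (Real.log x) = 0 := by
  refine Finset.sum_eq_zero fun a ha => Finset.sum_eq_zero fun b hb =>
    Finset.sum_eq_zero fun c hc => ?_
  contrapose! h
  simp only [ne_eq, mul_eq_zero, not_or, dilate] at h
  obtain ⟨⟨⟨h1, h2⟩, h3⟩, -, h4⟩ := h
  obtain ⟨h5, h6⟩ := mem_Icc_of_shortBump_ne_zero h4
  rw [le_div_iff₀ hδ0] at h5
  rw [div_le_iff₀ hδ0] at h6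
  exact hasNearbyAlmostCube_of_log hx (Finset.mem_Icc.1 ha).1 (Finset.mem_Icc.1 hb).1
    (Finset.mem_Icc.1 hc).1 hx1 hx2 hδ hδx (abs_sub_le_of_factorBump_ne_zero h1)
    (abs_sub_le_of_factorBump_ne_zero h2) (abs_sub_le_of_factorBump_ne_zero h3)
    (by linarith) (by linarith)

/-- From `exp y - 1 ≤ 2y` and `x ≤ 2X`: the divisor `4` absorbs both factors of `2`. -/
theorem mul_exp_le_add_rpow {X x ε : ℝ} (hX : 1 ≤ X) (hε : 0 < ε) (hε1 : ε ≤ 1 / 2)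
    (hx1 : X ≤ x) (hx2 : x ≤ 2 * X) :
    x * Real.exp (X ^ (ε - 1) / 4) ≤ x + x ^ ε := by
  have hX0 : 0 < X := by linarith
  have hp : X ^ (ε - 1) ≤ 1 := Real.rpow_le_one_of_one_le_of_nonpos hX (by linarith)
  have hp0 : 0 < X ^ (ε - 1) := Real.rpow_pos_of_pos hX0 _
  have h1 := Real.abs_exp_sub_one_le (x := X ^ (ε - 1) / 4) (by rw [abs_of_pos (by positivity)]; linarith)
  rw [abs_of_pos (show 0 < X ^ (ε - 1) / 4 by positivity)] at h1
  have h2 := (abs_le.1 h1).2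
  have h3 : X ^ (ε - 1) * X = X ^ ε := by
    nth_rewrite 2 [← Real.rpow_one X]
    rw [← Real.rpow_add hX0]; ring_nf
  have h4 : X ^ ε ≤ x ^ ε := Real.rpow_le_rpow hX0.le hx1 hε.le
  nlinarith

theorem integrable_sq_tripleSum (ρ : ℝ → ℝ) (L : ℝ) (M : ℕ) {κ : ℝ → ℝ} (hκ : Continuous κ)
    (hc : HasCompactSupport κ) : Integrable fun u => tripleSum ρ L M κ u ^ 2 := by
  have h1 : Continuous (tripleSum ρ L M κ) := by
    unfold tripleSum
    fun_prop
  have h2 := (hasCompactSupport_tripleSum ρ L M hc).mul_left (f := tripleSum ρ L M κ)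
  simpa only [pow_two] using! (h1.mul h1).integrable_of_hasCompactSupport h2

theorem volume_not_hasNearbyAlmostCube_le_integral {ε X L δ δ' : ℝ} {M : ℕ} (hX : 1 ≤ X)
    (hε : 0 < ε) (hε1 : ε ≤ 1 / 2) (hL : 3 * L = Real.log X) (hδ : δ = X ^ (ε - 1) / 4)
    (hM : 2 * Real.exp L ≤ M) (hδ' : 0 < δ') (hδ'1 : δ' ≤ Real.log 2 / 9)
    (hδL : 8 ≤ Real.exp L * δ') (hLL : 2 ≤ Real.exp L * (Real.log 2 / 24)) :
    volume.real {x : ℝ | x ∈ Icc X (2 * X) ∧ ¬ HasNearbyAlmostCube (1 / 4) 4 ε x} ≤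
      2 * X * ((∫ u, tripleSum factorBump L M
        (fun v => dilate shortBump δ v - dilate shortBump δ' v) u ^ 2) /
          (X * ((Real.log 2 / 24) ^ 2 / 32)) ^ 2) := by
  have hX0 : 0 < X := by linarith
  have hl0 : 0 < Real.log 2 := Real.log_pos one_lt_two
  have hp0 : 0 < X ^ (ε - 1) := Real.rpow_pos_of_pos hX0 _
  have hp1 : X ^ (ε - 1) ≤ 1 := Real.rpow_le_one_of_one_le_of_nonpos hX (by linarith)
  have hδ0 : 0 < δ := by rw [hδ]; positivity
  have hκ : ContDiff ℝ ∞ fun v => dilate shortBump δ v - dilate shortBump δ' v :=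
    (contDiff_dilate shortBump.contDiff δ).sub (contDiff_dilate shortBump.contDiff δ')
  have hκc : HasCompactSupport fun v => dilate shortBump δ v - dilate shortBump δ' v :=
    (hasCompactSupport_dilate shortBump.hasCompactSupport hδ0).sub
      (hasCompactSupport_dilate shortBump.hasCompactSupport hδ')
  have hDc : Continuous (tripleSum factorBump L M
      fun v => dilate shortBump δ v - dilate shortBump δ' v) :=
    (contDiff_tripleSum factorBump L M hκ).continuous
  have hDi := integrable_sq_tripleSum factorBump L M hκ.continuous hκc
  refine volume_real_le_of_exp hX0 hDc hDi (by positivity) ?_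
  rintro x ⟨⟨hx1, hx2⟩, hx⟩
  have hx0 : 0 < x := by linarith
  have hu1 : 3 * L ≤ Real.log x := by rw [hL]; exact Real.log_le_log hX0 hx1
  have hu2 : Real.log x ≤ 3 * L + Real.log 2 := by
    rw [hL, add_comm, ← Real.log_mul (by norm_num) hX0.ne']
    exact Real.log_le_log hx0 hx2
  refine ⟨⟨hx1, hx2⟩, ?_⟩
  have hz := tripleSum_eq_zero_of_not_hasNearbyAlmostCube (M := M) hx0 hu1 hu2 hδ0
    (by rw [hδ]; linarith) (by rw [hδ]; exact mul_exp_le_add_rpow hX hε hε1 hx1 hx2) hx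
  have hlow := le_tripleSum_dilate (fun x => factorBump.nonneg) (fun x => shortBump.nonneg)
    (fun x => factorBump_eq_one) (fun x => shortBump_eq_one) hM hδ' hδ'1 hδL hLL hu1 hu2
  rw [tripleSum_sub, hz, zero_sub, abs_neg]
  rw [hL, Real.exp_log hX0] at hlow
  exact hlow.trans (le_abs_self _)

theorem factorBump_shift_eq_zero {L u : ℝ} {M : ℕ} (hM : 2 * Real.exp L ≤ M)
    (hu : Real.log M < u) : factorBump (u - L) = 0 := by
  by_contra hne
  have h := (abs_le.1 (abs_sub_le_of_factorBump_ne_zero hne)).2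
  have h2 : Real.log 2 + L ≤ Real.log M := by
    have := Real.log_le_log (by positivity) hM
    rwa [Real.log_mul (by norm_num) (Real.exp_pos L).ne', Real.log_exp] at this
  linarith [Real.log_pos one_lt_two]

/-! ### Choice of parameters and conclusion. -/

/-- The exponent is `(1-ε)(1+ε) = 1 - ε²`; the saving `X^(-ε²)` is what makes the final bound
`o(X)`. -/
theorem short_scale_rpow {X ε : ℝ} (hX : 0 < X) :
    (X ^ (ε - 1) / 4) ^ (-1 - 6 * (ε / 6)) = X * X ^ (-ε ^ 2) * (1 / 4 : ℝ) ^ (-1 - ε) := by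
  have hp0 : 0 < X ^ (ε - 1) := Real.rpow_pos_of_pos hX _
  rw [show -1 - 6 * (ε / 6) = -1 - ε by ring, div_eq_mul_one_div,
    Real.mul_rpow hp0.le (by norm_num), ← Real.rpow_mul hX.le]
  nth_rewrite 2 [← Real.rpow_one X]
  rw [← Real.rpow_add hX]
  ring_nf

theorem normalised_bound {X p q k C d I : ℝ} (hX : 0 < X) (hp : 0 < p) (hq : 0 < q) (hk : 0 < k)
    (hC : 0 < C) (hd : 0 < d) (hI : I ≤ C * (X ^ 2 * p + X * (X * q * k))) :
    2 * X * (I / (X * d) ^ 2) ≤ 2 * C * (1 + k) / d ^ 2 * (X * (p + q)) := by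
  calc 2 * X * (I / (X * d) ^ 2)
      ≤ 2 * X * (C * (X ^ 2 * p + X * (X * q * k)) / (X * d) ^ 2) := by gcongr
    _ = 2 * C * X * (p + q * k) / d ^ 2 := by field_simp
    _ ≤ 2 * C * X * ((1 + k) * (p + q)) / d ^ 2 := by
      gcongr
      nlinarith [mul_pos hk hp]
    _ = _ := by ring

theorem exists_volume_not_hasNearbyAlmostCube_le (hL : LindelofHypothesis) {ε : ℝ} (hε : 0 < ε)
    (hε1 : ε ≤ 1 / 2) :
    ∃ C : ℝ, ∀ᶠ X : ℝ in atTop,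
      volume.real {x : ℝ | x ∈ Icc X (2 * X) ∧ ¬ HasNearbyAlmostCube (1 / 4) 4 ε x} ≤
        C * (X * (X ^ (-(1 / 3) : ℝ) + X ^ (-ε ^ 2))) := by
  obtain ⟨C, hC, hmain⟩ := exists_integral_sq_tripleSum_le hL (ρ := factorBump) (φ := shortBump)
    factorBump.contDiff factorBump.hasCompactSupport shortBump.contDiff
    shortBump.hasCompactSupport (η := ε / 6) (by positivity) (by linarith)
  have hl0 : 0 < Real.log 2 := Real.log_pos one_lt_two
  refine ⟨2 * C * (1 + (1 / 4 : ℝ) ^ (-1 - ε)) / ((Real.log 2 / 24) ^ 2 / 32) ^ 2, ?_⟩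
  have ev1 : ∀ᶠ X : ℝ in atTop, X ^ (-(1 / 6) : ℝ) < Real.log 2 / 9 :=
    (tendsto_rpow_neg_atTop (by norm_num : (0 : ℝ) < 1 / 6)).eventually_lt_const (by positivity)
  have ev2 : ∀ᶠ X : ℝ in atTop, 8 ≤ X ^ (1 / 6 : ℝ) :=
    (tendsto_rpow_atTop (by norm_num)).eventually_ge_atTop 8
  have ev3 : ∀ᶠ X : ℝ in atTop, 2 / (Real.log 2 / 24) ≤ X ^ (1 / 3 : ℝ) :=
    (tendsto_rpow_atTop (by norm_num)).eventually_ge_atTop _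
  filter_upwards [ev1, ev2, ev3, eventually_ge_atTop 1] with X h1 h2 h3 hX
  have hX0 : 0 < X := by linarith
  obtain ⟨L, h3L⟩ : ∃ L, 3 * L = Real.log X := ⟨Real.log X / 3, by ring⟩
  have e1 : Real.exp L = X ^ (1 / 3 : ℝ) := by
    rw [Real.rpow_def_of_pos hX0, ← h3L]; ring_nf
  have e3 : Real.exp (3 * L) = X := by rw [h3L, Real.exp_log hX0]
  have e6 : Real.exp (6 * L) = X ^ 2 := by
    rw [show 6 * L = (2 : ℕ) * (3 * L) by push_cast; ring, Real.exp_nat_mul, e3]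
  have hp0 : 0 < X ^ (ε - 1) := Real.rpow_pos_of_pos hX0 _
  have hp1 : X ^ (ε - 1) ≤ 1 := Real.rpow_le_one_of_one_le_of_nonpos hX (by linarith)
  have hpp : X ^ (ε - 1) ≤ X ^ (-(1 / 6) : ℝ) := Real.rpow_le_rpow_of_exponent_le hX (by linarith)
  obtain ⟨M, hM⟩ := exists_nat_ge (2 * Real.exp L)
  have hM0 : 0 < M := by
    have : (0 : ℝ) < M := lt_of_lt_of_le (by positivity) hM
    exact_mod_cast this
  -- The coarse scale `X^(-1/6)` tends to `0`, yet `exp L` times it is `X^(1/6)`, which tends to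
  -- infinity as the lower bound requires.
  have hI := hmain L M hM0 (fun u hu => factorBump_shift_eq_zero hM hu) (X ^ (ε - 1) / 4)
    (X ^ (-(1 / 6) : ℝ)) (by positivity) (by linarith) (by linarith)
  have hδ'2 : (X ^ (-(1 / 6) : ℝ)) ^ 2 = X ^ (-(1 / 3) : ℝ) := by
    rw [← Real.rpow_natCast, ← Real.rpow_mul hX0.le]; norm_num
  rw [e3, e6, short_scale_rpow hX0, hδ'2] at hI
  have h8 : 8 ≤ Real.exp L * X ^ (-(1 / 6) : ℝ) := by
    rw [e1, ← Real.rpow_add hX0]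
    convert h2 using 2
    norm_num
  have h24 : 2 ≤ Real.exp L * (Real.log 2 / 24) := by
    rw [e1]
    exact (div_le_iff₀ (by positivity)).1 h3
  exact (volume_not_hasNearbyAlmostCube_le_integral hX hε hε1 h3L rfl hM (by positivity) h1.le
    h8 h24).trans (normalised_bound hX0 (by positivity) (by positivity) (by positivity) hC
      (by positivity) hI)

theorem HasNearbyAlmostCube.mono {c C ε ε' x : ℝ} (hx : 1 ≤ x) (hε : ε ≤ ε')
    (h : HasNearbyAlmostCube c C ε x) : HasNearbyAlmostCube c C ε' x := by
  obtain ⟨n, f, h1, h2, h3⟩ := h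
  exact ⟨n, f, h1, ⟨h2.1, h2.2.trans (by gcongr)⟩, h3⟩

theorem theorem4 (hL : LindelofHypothesis) :
    ∃ c C : ℝ, 0 < c ∧ c < 1 ∧ 1 < C ∧ ∀ ε : ℝ, 0 < ε →
      (fun X : ℝ => MeasureTheory.volume.real
          {x : ℝ | x ∈ Set.Icc X (2 * X) ∧ ¬ HasNearbyAlmostCube c C ε x})
        =o[Filter.atTop] (fun X : ℝ => X) := by
  refine ⟨1 / 4, 4, by norm_num, by norm_num, by norm_num, fun ε hε => ?_⟩
  -- For `x ≥ 1` a smaller `ε` only enlarges the exceptional set, so `ε ≤ 1/2` may be assumed.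
  have hε₀ : 0 < min ε (1 / 2) := lt_min hε (by norm_num)
  obtain ⟨C, hC⟩ := exists_volume_not_hasNearbyAlmostCube_le hL hε₀ (min_le_right _ _)
  set ε₀ := min ε (1 / 2)
  have hO : (fun X : ℝ => volume.real
      {x : ℝ | x ∈ Icc X (2 * X) ∧ ¬ HasNearbyAlmostCube (1 / 4) 4 ε x}) =O[atTop]
      fun X : ℝ => X * (X ^ (-(1 / 3) : ℝ) + X ^ (-ε₀ ^ 2)) := by
    refine Asymptotics.IsBigO.of_bound C ?_
    filter_upwards [hC, eventually_ge_atTop 1] with X hX hX1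
    have hX0 : 0 < X := by linarith
    rw [Real.norm_of_nonneg measureReal_nonneg, Real.norm_of_nonneg (by positivity)]
    refine (measureReal_mono ?_ ?_).trans hX
    · rintro x ⟨hx, hn⟩
      exact ⟨hx, fun h => hn (h.mono (hX1.trans hx.1) (min_le_left _ _))⟩
    · exact measure_ne_top_of_subset (fun x hx => hx.1) (measure_Icc_lt_top (μ := volume)).ne
  refine hO.trans_isLittleO ?_
  have ht : Tendsto (fun X : ℝ => X ^ (-(1 / 3) : ℝ) + X ^ (-ε₀ ^ 2)) atTop (𝓝 0) := by
    simpa using (tendsto_rpow_neg_atTop (by norm_num : (0 : ℝ) < 1 / 3)).add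
      (tendsto_rpow_neg_atTop (by positivity : 0 < ε₀ ^ 2))
  simpa using (Asymptotics.isBigO_refl (fun X : ℝ => X) atTop).mul_isLittleO
    ((Asymptotics.isLittleO_one_iff ℝ).2 ht)
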